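/- Let $X$ be a standard Borel space, let $\mathcal R$ be a Borel equivalence relation on $X$ with countable classes, and let $(\mathcal R_i)_{i\in I}$ be a countable family of Borel equivalence relations on $X$ such that $\mathcal R=\star_{i\in I}\mathcal R_i$. Here a relation on a Borel subset of $X$ is called a subrelation of $\mathcal R$ if its graph is contained in $\mathcal R$. An equivalence relation $\mathcal Q$ on $X$ is the *free product* $\star_{j\in J}\mathcal E_j$ of a countable family of Borel equivalence relations $\mathcal E_j$, each defined on a Borel subset of $X$, if $\mathcal Q$ is the smallest equivalence relation on $X$ containing all the $\mathcal E_j$ and if, for all $n\ge 2$, all points $x_1,\dots,x_n$ of $X$ with $x_n=x_1$ and all $j_1,\dots,j_{n-1}\in J$ with $(x_k,x_{k+1})\in\mathcal E_{j_k}$ for $1\le k\le n-1$ and $j_k\ne j_{k+1}$ for $1\le k\le n-2$, there is $1\le k\le n-1$ with $x_k=x_{k+1}$. The *full pseudogroup* $[[\mathcal R]]$ is the set of Borel isomorphisms $\phi:A\to B$ between Borel subsets of $X$ such that $(x,\phi(x))\in\mathcal R$ for all $x\in A$. For such a $\phi$ and an equivalence relation $\mathcal E$ on $\phi(A)$, $\phi^{-1}\mathcal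 E\phi$ is the relation on $A$ in which $x,y$ are equivalent when $(\phi(x),\phi(y))\in\mathcal E$. A Borel equivalence relation on $X$ is *treeable* if there is a symmetric, irreflexive Borel subset of $X\times X$ which, seen as a graph on $X$, has no cycles and has the equivalence classes as its connected components. Let $\mathcal S\subseteq\mathcal R$ be a Borel equivalence relation on $X$. Then there are countable sets $K(i)$ ($i\in I$), elements $\phi_{i,k}$ of $[[\mathcal R]]$ ($i\in I$, $k\in K(i)$), defined on Borel subsets $A_{i,k}$ of $X$, and a treeable Borel equivalence relation $\mathcal T\subseteq\mathcal S$ on $X$ such that $$\mathcal S=\star_{i\in I}\bigl(\star_{k\in K(i)}\mathcal S_{i,k}\bigr)\star\mathcal T,\qquad \mathcal S_{i,k}=\bigl(\phi_{i,k}^{-1}\,\mathcal R_i|_{\phi_{i,k}(A_{i,k})}\,\phi_{i,k}\bigr)\cap\mathcal S,$$ that is, $\mathcal S$ is the free product of the countable family consisting of all the $\mathcal S_{i,k}$ ($i\in I$, $k\in K(i)$) together with $\mathcal T$. Moreover, for every $i\in I$ there is $k\in K(i)$ such that $A_{i,k}=X$ and $\mathcal S_{i,k}=\mathcal R_i\cap\mathcal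 S$. -/

import Mathlib

/-- A Borel equivalence relation: one whose graph is a measurable subset of `X × X`. -/
def IsBorelRel {X : Type*} [MeasurableSpace X] (E : Setoid X) : Prop :=
  MeasurableSet {p : X × X | E p.1 p.2}

/-- All equivalence classes of `E` are countable. -/
def HasCountableClasses {X : Type*} (E : Setoid X) : Prop :=
  ∀ x : X, {y : X | E x y}.Countable

/-- The full pseudogroup `[[R]]`: the Borel isomorphisms `φ : A → B` between Borel subsets
`A = φ.source` and `B = φ.target` of `X` whose graph is contained in `R`. -/
def fullPseudogroup {X : Type*} [MeasurableSpace X] (R : Setoid X) : Set (PartialEquiv X X) :=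
  {φ | MeasurableSet φ.source ∧ MeasurableSet φ.target ∧
    Measurable (fun x : φ.source => φ x) ∧ Measurable (fun y : φ.target => φ.symm y) ∧
    ∀ x ∈ φ.source, R x (φ x)}

/-- The restriction `E|_B` of a relation to a subset `B`, as a relation defined on `B`. -/
def restrictRel {X : Type*} (E : X → X → Prop) (B : Set X) (x y : X) : Prop :=
  x ∈ B ∧ y ∈ B ∧ E x y

/-- The conjugate `φ⁻¹ E φ`, a relation defined on the source of `φ`: two points `x, y` of the
source are related when `φ x` and `φ y` are `E`-related. -/
def conjRel {X : Type*} (φ : PartialEquiv X X) (E : X → X → Prop) (x y : X) : Prop :=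
  x ∈ φ.source ∧ y ∈ φ.source ∧ E (φ x) (φ y)

/-- `R` is the free product of the family `E`. Each `E j` is meant to be an equivalence relation
on a subset of `X`. The family generates `R` as an equivalence relation on `X`, and along every
closed path `x 0, x 1, …, x n = x 0` with `n ≥ 1` steps, the `k`-th step being an `E (c k)`-step
and consecutive indices `c k`, `c (k + 1)` being distinct, some step is trivial. -/
def IsFreeProduct {X : Type*} {J : Type*} (R : Setoid X) (E : J → X → X → Prop) : Prop :=
  (∀ x y : X, R x y ↔ Relation.EqvGen (fun a b => ∃ j, E j a b) x y) ∧
  ∀ (n : ℕ) (x : ℕ → X) (c : ℕ → J), 1 ≤ n →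
    (∀ k, k < n → E (c k) (x k) (x (k + 1))) →
    (∀ k, k + 1 < n → c k ≠ c (k + 1)) →
    x n = x 0 →
    ∃ k, k < n ∧ x k = x (k + 1)

/-- `E` is treeable: there is a Borel graph on `X` without cycles whose connected components are
exactly the classes of `E`, so that it makes each class a tree. -/
def IsTreeable {X : Type*} [MeasurableSpace X] (E : Setoid X) : Prop :=
  ∃ G : SimpleGraph X, MeasurableSet {p : X × X | G.Adj p.1 p.2} ∧ G.IsAcyclic ∧
    ∀ x y : X, E x y ↔ G.Reachable x y

/-- The relation `(φ⁻¹ E|_{φ(A)} φ) ∩ S`, where `A` is the source of `φ`. -/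
def kuroshFactor {X : Type*} (E S : Setoid X) (φ : PartialEquiv X X) (x y : X) : Prop :=
  conjRel φ (restrictRel E (φ '' φ.source)) x y ∧ S x y

open Set Filter Topology MeasureTheory

/-! ### Lusin–Novikov: covering by Borel graphs of functions -/

/-- Every vertical section of `G` has at most one point. -/
def IsFunctionalGraph {X Y : Type*} (G : Set (X × Y)) : Prop :=
  ∀ x y y', (x, y) ∈ G → (x, y') ∈ G → y = y'

/-- The sequences of natural numbers that start with the finite sequence `s`. -/
def seqCylinder (s : List ℕ) : Set (ℕ → ℕ) :=
  {z | ∀ i (h : i < s.length), z i = s[i]}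

theorem isClosed_seqCylinder (s : List ℕ) : IsClosed (seqCylinder s) := by
  simp only [seqCylinder, ofPred_forall]
  exact isClosed_iInter fun i => isClosed_iInter fun _ =>
    isClosed_eq (continuous_apply i) continuous_const

/-- The cylinder around `z` given by its first `n` values. -/
def seqPrefix (z : ℕ → ℕ) (n : ℕ) : List ℕ := List.ofFn fun i : Fin n => z i

theorem mem_seqCylinder_seqPrefix {z w : ℕ → ℕ} {n : ℕ} :
    w ∈ seqCylinder (seqPrefix z n) ↔ ∀ i < n, w i = z i := by
  simp [seqCylinder, seqPrefix]

theorem isPrefix_seqPrefix {s : List ℕ} {z : ℕ → ℕ} (hz : z ∈ seqCylinder s) {n : ℕ}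
    (hn : s.length ≤ n) : s <+: seqPrefix z n := by
  rw [List.prefix_iff_getElem]
  refine ⟨by simpa [seqPrefix] using hn, fun i hi => ?_⟩
  simp [seqPrefix, hz i hi]

theorem eventually_seqCylinder_subset {z : ℕ → ℕ} {U : Set (ℕ → ℕ)} (hU : IsOpen U)
    (hz : z ∈ U) : ∀ᶠ n in atTop, seqCylinder (seqPrefix z n) ⊆ U := by
  by_contra h
  rw [not_eventually] at h
  have h' : ∃ᶠ n in atTop, ∃ w, w ∈ seqCylinder (seqPrefix z n) ∧ w ∉ U :=
    h.mono fun n hn => not_subset.1 hn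
  obtain ⟨ns, hns, hw⟩ := extraction_of_frequently_atTop h'
  choose w hw hwU using hw
  have : Tendsto w atTop (𝓝 z) := by
    rw [tendsto_pi_nhds]
    intro i
    apply tendsto_const_nhds.congr'
    filter_upwards [eventually_gt_atTop i] with n hn
    exact (mem_seqCylinder_seqPrefix.1 (hw n) i (hn.trans_le (hns.id_le n))).symm
  obtain ⟨n, hn⟩ := (this.eventually (hU.mem_nhds hz)).exists
  exact hwU n hn

/-- An analytic set with functional sections is contained in a Borel one. -/
theorem AnalyticSet.exists_measurableSet_isFunctionalGraph {X Y : Type*}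
    [TopologicalSpace X] [PolishSpace X] [MeasurableSpace X] [BorelSpace X]
    [TopologicalSpace Y] [PolishSpace Y] [MeasurableSpace Y] [BorelSpace Y]
    {G : Set (X × Y)} (hG : AnalyticSet G) (hf : IsFunctionalGraph G) :
    ∃ G', G ⊆ G' ∧ MeasurableSet G' ∧ IsFunctionalGraph G' := by
  have inter : ∀ {A B : Set (X × Y)}, AnalyticSet A → AnalyticSet B → AnalyticSet (A ∩ B) := by
    intro A B hA hB
    rw [inter_eq_iInter]
    exact AnalyticSet.iInter fun b => by cases b <;> assumption
  -- The points of the projection lying under `U` and under its complement form disjoint analytic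
  -- sets, since sections are functional. A Borel separator for each basic open set determines the
  -- second coordinate from the first.
  have key : ∀ U : Set Y, MeasurableSet U → ∃ W : Set X, MeasurableSet W ∧
      ∀ p ∈ G, (p.1 ∈ W ↔ p.2 ∈ U) := by
    intro U hU
    have a1 : AnalyticSet (Prod.fst '' (G ∩ Prod.snd ⁻¹' U)) :=
      (inter hG (measurable_snd hU).analyticSet).image_of_continuous continuous_fst
    have a2 : AnalyticSet (Prod.fst '' (G ∩ Prod.snd ⁻¹' Uᶜ)) :=
      (inter hG (measurable_snd hU.compl).analyticSet).image_of_continuous continuous_fst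
    have hd : Disjoint (Prod.fst '' (G ∩ Prod.snd ⁻¹' U))
        (Prod.fst '' (G ∩ Prod.snd ⁻¹' Uᶜ)) := by
      rw [Set.disjoint_left]
      rintro _ ⟨⟨x, y⟩, ⟨h1, h2⟩, rfl⟩ ⟨⟨x', y'⟩, ⟨h3, h4⟩, h5⟩
      obtain rfl : x' = x := h5
      obtain rfl := hf _ _ _ h1 h3
      exact h4 h2
    obtain ⟨W, hW1, hW2, hW⟩ := a1.measurablySeparable a2 hd
    refine ⟨W, hW, fun p hp => ⟨fun h => ?_, fun h => hW1 ⟨p, ⟨hp, h⟩, rfl⟩⟩⟩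
    by_contra h'
    exact Set.disjoint_left.1 hW2 ⟨p, ⟨hp, h'⟩, rfl⟩ h
  choose! W hW hWG using key
  let b := TopologicalSpace.countableBasis Y
  have hb : ∀ U ∈ b, MeasurableSet U := fun U hU =>
    (TopologicalSpace.isOpen_of_mem_countableBasis hU).measurableSet
  refine ⟨{p | ∀ U ∈ b, (p.1 ∈ W U ↔ p.2 ∈ U)}, fun p hp U hU => hWG U (hb U hU) p hp, ?_, ?_⟩
  · have : {p : X × Y | ∀ U ∈ b, (p.1 ∈ W U ↔ p.2 ∈ U)} =
        ⋂ U ∈ b, {p : X × Y | (p.1 ∈ W U ↔ p.2 ∈ U)} := by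
      ext p; simp
    rw [this]
    exact MeasurableSet.biInter (TopologicalSpace.countable_countableBasis Y) fun U hU =>
      (measurable_fst (hW U (hb U hU))).iff (measurable_snd (hb U hU))
  · intro x y y' h h'
    by_contra hne
    obtain ⟨U, hU, hyU, hUs⟩ := (TopologicalSpace.isBasis_countableBasis Y).exists_subset_of_mem_open
      (show y ∈ ({y'}ᶜ : Set Y) from hne) isOpen_compl_singleton
    exact hUs ((h' U hU).1 ((h U hU).2 hyU)) rfl

/-- Along the parametrization `F`, a tuple of cylinders is killed if, after removal of countably
many Borel graphs of functions, the images of the cylinders have no common vertical section. -/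
def IsKilled {X Y : Type*} [MeasurableSpace X] [MeasurableSpace Y] (F : (ℕ → ℕ) → X × Y)
    (𝒮 : Finset (List ℕ)) (𝒢 : Set (Set (X × Y))) : Prop :=
  𝒢.Countable ∧ (∀ G ∈ 𝒢, MeasurableSet G ∧ IsFunctionalGraph G) ∧
    ∀ x, ∃ s ∈ 𝒮, ∀ z ∈ seqCylinder s, (F z).1 = x → F z ∈ ⋃₀ 𝒢

/-- There are countably many finite families of finite sequences, so one killer per family can be
pooled; enlarging a killer keeps it a killer. -/
theorem exists_universal_killer {X Y : Type*} [MeasurableSpace X] [MeasurableSpace Y]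
    (F : (ℕ → ℕ) → X × Y) :
    ∃ 𝒢₀ : Set (Set (X × Y)), 𝒢₀.Countable ∧ (∀ G ∈ 𝒢₀, MeasurableSet G ∧ IsFunctionalGraph G) ∧
      ∀ 𝒮, (∃ 𝒢, IsKilled F 𝒮 𝒢) → IsKilled F 𝒮 𝒢₀ := by
  classical
  let g : Finset (List ℕ) → Set (Set (X × Y)) := fun 𝒮 =>
    if h : ∃ 𝒢, IsKilled F 𝒮 𝒢 then h.choose else ∅
  have hg : ∀ 𝒮, (∃ 𝒢, IsKilled F 𝒮 𝒢) → IsKilled F 𝒮 (g 𝒮) := by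
    intro 𝒮 h
    simp only [g, dif_pos h]
    exact h.choose_spec
  have h1 : (⋃ 𝒮, g 𝒮).Countable := by
    refine countable_iUnion fun 𝒮 => ?_
    by_cases h : ∃ 𝒢, IsKilled F 𝒮 𝒢
    · exact (hg 𝒮 h).1
    · simp [g, dif_neg h]
  have h2 : ∀ G ∈ ⋃ 𝒮, g 𝒮, MeasurableSet G ∧ IsFunctionalGraph G := by
    intro G hG
    obtain ⟨𝒮, hG⟩ := mem_iUnion.1 hG
    by_cases h : ∃ 𝒢, IsKilled F 𝒮 𝒢
    · exact (hg 𝒮 h).2.1 G hG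
    · simp [g, dif_neg h] at hG
  refine ⟨_, h1, h2, fun 𝒮 h => ⟨h1, h2, fun x => ?_⟩⟩
  obtain ⟨s, hs, H⟩ := (hg 𝒮 h).2.2 x
  exact ⟨s, hs, fun z hz hx => sUnion_mono (subset_iUnion g 𝒮) (H z hz hx)⟩

section Scheme

variable {X Y : Type*} [TopologicalSpace X] [PolishSpace X] [MeasurableSpace X] [BorelSpace X]
  [TopologicalSpace Y] [PolishSpace Y] [MeasurableSpace Y] [BorelSpace Y]
  {F : (ℕ → ℕ) → X × Y}

/-- `t` and `t'` properly extend `s` and their cylinders have disjoint second projections. -/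
def IsSplitting (F : (ℕ → ℕ) → X × Y) (s t t' : List ℕ) : Prop :=
  s <+: t ∧ s <+: t' ∧ s.length < t.length ∧ s.length < t'.length ∧
    ∀ z ∈ seqCylinder t, ∀ z' ∈ seqCylinder t', (F z).2 ≠ (F z').2

/-- If the universal killer `𝒢₀` killed all splittings, consider the part of the cylinder of `s`
outside `⋃₀ 𝒢₀`, over those `x` where every cylinder still has a surviving point. Two surviving
points over one `x` would be separated by an unkilled splitting. So this part is an analytic
functional graph, and a Borel one around it, added to `𝒢₀`, kills the original family. -/
theorem exists_isSplitting_not_isKilled (hF : Continuous F) {s : List ℕ} {U : Finset (List ℕ)}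
    (h : ¬ ∃ 𝒢, IsKilled F (insert s U) 𝒢) :
    ∃ t t', IsSplitting F s t t' ∧ ¬ ∃ 𝒢, IsKilled F (insert t (insert t' U)) 𝒢 := by
  by_contra! hcon
  obtain ⟨𝒢₀, hc, hm, huniv⟩ := exists_universal_killer F
  have hC : MeasurableSet (⋃₀ 𝒢₀) := MeasurableSet.sUnion hc fun G hG => (hm G hG).1
  let A : Set X := ⋂ w : (insert s U : Finset (List ℕ)),
    (fun z => (F z).1) '' (seqCylinder w ∩ F ⁻¹' (⋃₀ 𝒢₀)ᶜ)
  have hcyl : ∀ w : List ℕ, AnalyticSet (seqCylinder w ∩ F ⁻¹' (⋃₀ 𝒢₀)ᶜ) := fun w =>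
    ((isClosed_seqCylinder w).measurableSet.inter (hF.measurable hC.compl)).analyticSet
  have hA : AnalyticSet A := by
    have : Nonempty (insert s U : Finset (List ℕ)) := ⟨⟨s, Finset.mem_insert_self _ _⟩⟩
    exact AnalyticSet.iInter fun w => (hcyl w).image_of_continuous (continuous_fst.comp hF)
  let G : Set (X × Y) := F '' (seqCylinder s ∩ F ⁻¹' (⋃₀ 𝒢₀)ᶜ) ∩ Prod.fst ⁻¹' A
  have hG : AnalyticSet G := by
    simp only [G]
    rw [inter_eq_iInter]
    refine AnalyticSet.iInter fun b => ?_
    cases b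
    · exact hA.preimage continuous_fst
    · exact (hcyl s).image_of_continuous hF
  have hGf : IsFunctionalGraph G := by
    rintro x y y' ⟨⟨z, ⟨hz, hzC⟩, hzx⟩, hxA⟩ ⟨⟨z', ⟨hz', hzC'⟩, hzx'⟩, -⟩
    by_contra hne
    obtain ⟨V, V', hV, hV', hyV, hyV', hd⟩ := t2_separation hne
    have c : Continuous fun z => (F z).2 := continuous_snd.comp hF
    obtain ⟨n, hn, hn', hl⟩ :=
      ((eventually_seqCylinder_subset (hV.preimage c) (show z ∈ _ by simpa [hzx])).and
      ((eventually_seqCylinder_subset (hV'.preimage c) (show z' ∈ _ by simpa [hzx'])).and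
        (eventually_gt_atTop s.length))).exists
    have hk := huniv _ (hcon (seqPrefix z n) (seqPrefix z' n)
      ⟨isPrefix_seqPrefix hz hl.le, isPrefix_seqPrefix hz' hl.le, by simpa [seqPrefix] using hl,
        by simpa [seqPrefix] using hl,
        fun w hw w' hw' h => Set.disjoint_left.1 hd (hn hw) (by
          have := hn' hw'
          rwa [mem_preimage, ← h] at this)⟩)
    obtain ⟨w, hw, hwk⟩ := hk.2.2 x
    rcases Finset.mem_insert.1 hw with rfl | hw
    · exact hzC (hwk z (mem_seqCylinder_seqPrefix.2 fun _ _ => rfl) (by rw [hzx]))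
    rcases Finset.mem_insert.1 hw with rfl | hw
    · exact hzC' (hwk z' (mem_seqCylinder_seqPrefix.2 fun _ _ => rfl) (by rw [hzx']))
    · obtain ⟨v, ⟨hv, hvC⟩, hvx⟩ := mem_iInter.1 hxA ⟨w, Finset.mem_insert_of_mem hw⟩
      exact hvC (hwk v hv hvx)
  obtain ⟨G', hGG', hG'm, hG'f⟩ := AnalyticSet.exists_measurableSet_isFunctionalGraph hG hGf
  refine h ⟨insert G' 𝒢₀, hc.insert _, ?_, fun x => ?_⟩
  · rintro K (rfl | hK)
    · exact ⟨hG'm, hG'f⟩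
    · exact hm K hK
  · by_cases hx : x ∈ A
    · refine ⟨s, Finset.mem_insert_self _ _, fun z hz hzx => ?_⟩
      by_cases hzC : F z ∈ ⋃₀ 𝒢₀
      · exact sUnion_mono (subset_insert _ _) hzC
      · exact ⟨G', mem_insert _ _, hGG' ⟨⟨z, ⟨hz, hzC⟩, rfl⟩, by simpa [hzx] using hx⟩⟩
    · simp only [A, mem_iInter, not_forall] at hx
      obtain ⟨w, hw⟩ := hx
      refine ⟨w, w.2, fun z hz hzx => sUnion_mono (subset_insert _ _) ?_⟩
      by_contra hzC
      exact hw ⟨z, ⟨hz, hzC⟩, hzx⟩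

/-- `W` carries the children already obtained, so that sequences are split one at a time while the
whole family stays unkilled. -/
theorem exists_forall_isSplitting_not_isKilled (hF : Continuous F) (U W : Finset (List ℕ))
    (h : ¬ ∃ 𝒢, IsKilled F (U ∪ W) 𝒢) :
    ∃ l r : List ℕ → List ℕ, (∀ s ∈ U, IsSplitting F s (l s) (r s)) ∧
      ¬ ∃ 𝒢, IsKilled F (U.image l ∪ U.image r ∪ W) 𝒢 := by
  induction U using Finset.induction_on generalizing W with
  | empty => exact ⟨id, id, by simp, by simpa using h⟩
  | insert s U hs ih =>
    rw [Finset.insert_union] at h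
    obtain ⟨t, t', htt, hk⟩ := exists_isSplitting_not_isKilled hF h
    obtain ⟨l, r, hlr, hk'⟩ := ih (insert t (insert t' W)) (by
      rwa [Finset.union_insert, Finset.union_insert])
    have e : ∀ (f : List ℕ → List ℕ) (v : List ℕ),
        (insert s U).image (Function.update f s v) = insert v (U.image f) := by
      intro f v
      rw [Finset.image_insert, Function.update_self]
      congr 1
      exact Finset.image_congr fun a ha =>
        Function.update_of_ne (fun hh => hs (by rwa [← hh])) _ _
    refine ⟨Function.update l s t, Function.update r s t', ?_, ?_⟩
    · intro a ha
      by_cases has : a = s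
      · subst has; simpa using htt
      · simpa [Function.update_of_ne has] using
          hlr a ((Finset.mem_insert.1 ha).resolve_left has)
    · rw [e, e]
      rwa [show insert t (U.image l) ∪ insert t' (U.image r) ∪ W =
        U.image l ∪ U.image r ∪ insert t (insert t' W) by
          ext; simp only [Finset.mem_union, Finset.mem_insert]; tauto]

/-- A Borel set with countable vertical sections, parametrized by `F`, is covered by countably many
Borel graphs of functions. -/
theorem exists_isKilled_of_countable (hF : Continuous F)
    (hcount : ∀ x, {y | (x, y) ∈ range F}.Countable) : ∃ 𝒢, IsKilled F {[]} 𝒢 := by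
  classical
  by_contra h0
  choose l r hlr hk using fun 𝒮 : {𝒮 : Finset (List ℕ) // ¬ ∃ 𝒢, IsKilled F 𝒮 𝒢} =>
    exists_forall_isSplitting_not_isKilled hF 𝒮.1 ∅ (by simpa using 𝒮.2)
  let stage : ℕ → {𝒮 : Finset (List ℕ) // ¬ ∃ 𝒢, IsKilled F 𝒮 𝒢} := fun n =>
    Nat.rec ⟨{[]}, h0⟩ (fun _ 𝒮 => ⟨𝒮.1.image (l 𝒮) ∪ 𝒮.1.image (r 𝒮) ∪ ∅, hk 𝒮⟩) n
  let node : (ℕ → Bool) → ℕ → List ℕ := fun b n =>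
    Nat.rec [] (fun n s => if b n then r (stage n) s else l (stage n) s) n
  have node_succ : ∀ b n, node b (n + 1) =
    if b n then r (stage n) (node b n) else l (stage n) (node b n) := fun _ _ => rfl
  have hmem : ∀ b n, node b n ∈ (stage n).1 := by
    intro b n
    induction n with
    | zero => exact Finset.mem_singleton_self _
    | succ n ih =>
      change node b (n + 1) ∈ (stage n).1.image _ ∪ (stage n).1.image _ ∪ ∅
      rw [Finset.union_empty, Finset.mem_union, node_succ]
      split_ifs
      · exact Or.inr (Finset.mem_image_of_mem _ ih)
      · exact Or.inl (Finset.mem_image_of_mem _ ih)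
  have hsplit := fun b n => hlr (stage n) _ (hmem b n)
  have hstep : ∀ b n, node b n <+: node b (n + 1) ∧
      (node b n).length < (node b (n + 1)).length := by
    intro b n
    rw [node_succ]
    split_ifs
    · exact ⟨(hsplit b n).2.1, (hsplit b n).2.2.2.1⟩
    · exact ⟨(hsplit b n).1, (hsplit b n).2.2.1⟩
  have hlen : ∀ b n, n ≤ (node b n).length := by
    intro b n
    induction n with
    | zero => simp
    | succ n ih => exact ih.trans_lt (hstep b n).2
  have hpre : ∀ b m n, m ≤ n → node b m <+: node b n := by
    intro b m n hmn
    induction n, hmn using Nat.le_induction with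
    | base => exact List.prefix_rfl
    | succ n _ ih => exact ih.trans (hstep b n).1
  let z : (ℕ → Bool) → ℕ → ℕ := fun b i => (node b (i + 1))[i]'(hlen b (i + 1))
  have hz : ∀ b n, z b ∈ seqCylinder (node b n) := by
    intro b n i hi
    rcases le_total n (i + 1) with h | h
    · exact ((hpre b _ _ h).getElem hi).symm
    · exact (hpre b _ _ h).getElem (hlen b (i + 1))
  -- The empty collection of graphs is not a killer, so all cylinders of a stage meet one common
  -- vertical section.
  have hpt : ∀ n, ∃ x, ∀ s ∈ (stage n).1, ∃ w ∈ seqCylinder s, (F w).1 = x := by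
    intro n
    by_contra! hcon
    exact (stage n).2 ⟨∅, countable_empty, by simp, fun x => by
      obtain ⟨s, hs, H⟩ := hcon x
      exact ⟨s, hs, fun z hz hx => (H z hz hx).elim⟩⟩
  choose x hx using hpt
  -- The sequence `x` does not depend on `b`, so all branches end in the same vertical section.
  have hlim : ∀ b, Tendsto x atTop (𝓝 (F (z b)).1) := by
    intro b
    choose w hw hwx using fun n => hx n _ (hmem b n)
    have : Tendsto w atTop (𝓝 (z b)) := by
      rw [tendsto_pi_nhds]
      intro i
      apply tendsto_const_nhds.congr'
      filter_upwards [eventually_gt_atTop i] with n hn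
      rw [hw n i (hn.trans_le (hlen b n)), hz b n i (hn.trans_le (hlen b n))]
    refine (((continuous_fst.comp hF).tendsto _).comp this).congr fun n => ?_
    exact hwx n
  have hinj : Function.Injective fun b => (F (z b)).2 := by
    intro b b' hbb
    by_contra hne
    have hex : ∃ n, b n ≠ b' n := Function.ne_iff.1 hne
    have hn := Nat.find_spec hex
    set n := Nat.find hex
    have heq : ∀ m ≤ n, node b m = node b' m := by
      intro m hm
      induction m with
      | zero => rfl
      | succ m ih =>
        have : b m = b' m := not_not.1 (Nat.find_min hex hm)
        rw [node_succ, node_succ, ih (Nat.le_of_succ_le hm), this]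
    have h1 := hz b (n + 1)
    have h2 := hz b' (n + 1)
    rw [node_succ] at h1 h2
    rw [← heq n le_rfl] at h2
    have hsp := (hsplit b n).2.2.2.2
    cases hb : b n <;> cases hb' : b' n
    · exact hn (hb.trans hb'.symm)
    · rw [hb] at h1; rw [hb'] at h2; exact hsp _ h1 _ h2 hbb
    · rw [hb] at h1; rw [hb'] at h2; exact hsp _ h2 _ h1 hbb.symm
    · exact hn (hb.trans hb'.symm)
  have hx0 : ∀ b, (F (z b)).1 = (F (z fun _ => true)).1 := fun b =>
    tendsto_nhds_unique (hlim b) (hlim _)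
  have huncount : ¬ (range fun b => (F (z b)).2).Countable := by
    intro hc
    have : Countable (ℕ → Bool) := by
      rw [← image_univ] at hc
      exact countable_univ_iff.1 (countable_of_injective_of_countable_image hinj.injOn hc)
    obtain ⟨f, hf⟩ := exists_surjective_nat (ℕ → Bool)
    obtain ⟨n, hn⟩ := hf fun n => !(f n n)
    simpa using congrFun hn n
  exact huncount ((hcount (F (z fun _ => true)).1).mono (by
    rintro _ ⟨b, rfl⟩
    exact ⟨z b, Prod.ext (hx0 b) rfl⟩))

end Scheme

/-- **Lusin–Novikov**: a Borel set with countable vertical sections is covered by countably many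
Borel graphs of functions. -/
theorem MeasurableSet.exists_countable_cover_isFunctionalGraph {X Y : Type*}
    [MeasurableSpace X] [StandardBorelSpace X] [MeasurableSpace Y] [StandardBorelSpace Y]
    {P : Set (X × Y)} (hP : MeasurableSet P) (hc : ∀ x, {y | (x, y) ∈ P}.Countable) :
    ∃ G : ℕ → Set (X × Y), (∀ n, MeasurableSet (G n) ∧ IsFunctionalGraph (G n)) ∧
      P ⊆ ⋃ n, G n := by
  let _ := upgradeStandardBorel X
  let _ := upgradeStandardBorel Y
  have hA := hP.analyticSet
  rw [AnalyticSet] at hA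
  rcases hA with rfl | ⟨F, hF, rfl⟩
  · exact ⟨fun _ => ∅, fun _ => ⟨MeasurableSet.empty, fun _ _ _ h => h.elim⟩, empty_subset _⟩
  · obtain ⟨𝒢, h𝒢c, h𝒢, hk⟩ := exists_isKilled_of_countable hF hc
    have hcov : range F ⊆ ⋃₀ 𝒢 := by
      rintro _ ⟨z, rfl⟩
      obtain ⟨s, hs, H⟩ := hk (F z).1
      rw [Finset.mem_singleton] at hs
      subst hs
      exact H z (fun i hi => by simp at hi) rfl
    obtain ⟨G, hG⟩ := (h𝒢c.insert ∅).exists_eq_range (insert_nonempty _ _)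
    refine ⟨G, fun n => ?_, fun p hp => ?_⟩
    · have : G n ∈ insert ∅ 𝒢 := hG ▸ mem_range_self n
      rcases this with h | h
      · rw [h]; exact ⟨MeasurableSet.empty, fun _ _ _ h => h.elim⟩
      · exact h𝒢 _ h
    · obtain ⟨g, hg, hpg⟩ := hcov hp
      obtain ⟨n, rfl⟩ : g ∈ range G := hG ▸ mem_insert_of_mem _ hg
      exact mem_iUnion.2 ⟨n, hpg⟩


/-! ### Borel enumeration of the classes -/

/-- The first projection is injective on `H`, so it maps Borel subsets of `H` to Borel sets
(Lusin–Souslin). The identity extends the map off the projection and stays inside the classes. -/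
theorem exists_measurable_of_isFunctionalGraph {X : Type*} [MeasurableSpace X]
    [StandardBorelSpace X] (R : Setoid X) {H : Set (X × X)} (hH : MeasurableSet H)
    (hf : IsFunctionalGraph H) (hf' : ∀ x x' y, (x, y) ∈ H → (x', y) ∈ H → x = x')
    (hHR : ∀ x y, (x, y) ∈ H → R x y) :
    ∃ (h : X → X) (D : Set X), Measurable h ∧ MeasurableSet D ∧ InjOn h D ∧ (∀ x, R x (h x)) ∧
      ∀ x y, (x, y) ∈ H → x ∈ D ∧ h x = y := by
  classical
  let h : X → X := fun x => if hx : ∃ y, (x, y) ∈ H then hx.choose else x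
  have hh : ∀ x y, (x, y) ∈ H → h x = y := fun x y hxy => by
    have hx : ∃ y, (x, y) ∈ H := ⟨y, hxy⟩
    simp only [h, dif_pos hx]
    exact hf _ _ _ hx.choose_spec hxy
  have hnot : ∀ x, (¬ ∃ y, (x, y) ∈ H) → h x = x := fun x hx => by simp only [h, dif_neg hx]
  have hinj : InjOn Prod.fst H := by
    rintro ⟨x, y⟩ hp ⟨x', y'⟩ hp' hxx
    obtain rfl : x = x' := hxx
    rw [hf _ _ _ hp hp']
  have himg : ∀ U, MeasurableSet U → MeasurableSet (Prod.fst '' (H ∩ Prod.snd ⁻¹' U)) :=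
    fun U hU => (hH.inter (measurable_snd hU)).image_of_measurable_injOn measurable_fst
      (hinj.mono inter_subset_left)
  have hD : MeasurableSet (Prod.fst '' H) := hH.image_of_measurable_injOn measurable_fst hinj
  refine ⟨h, Prod.fst '' H, ?_, hD, ?_, ?_, fun x y hxy => ⟨⟨_, hxy, rfl⟩, hh x y hxy⟩⟩
  · intro U hU
    convert! (himg U hU).union (hD.compl.inter hU) using 1
    ext x
    constructor
    · intro hx
      by_cases hex : ∃ y, (x, y) ∈ H
      · obtain ⟨y, hy⟩ := hex
        refine Or.inl ⟨(x, y), ⟨hy, ?_⟩, rfl⟩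
        rwa [mem_preimage, hh x y hy] at hx
      · refine Or.inr ⟨?_, by rwa [mem_preimage, hnot x hex] at hx⟩
        rintro ⟨⟨x', y⟩, hp, rfl⟩
        exact hex ⟨y, hp⟩
    · rintro (⟨⟨x', y⟩, ⟨hp, hy⟩, rfl⟩ | ⟨hx, hxU⟩)
      · rwa [mem_preimage, hh _ y hp]
      · rwa [mem_preimage, hnot x]
        rintro ⟨y, hy⟩
        exact hx ⟨_, hy, rfl⟩
  · rintro _ ⟨⟨x, y⟩, hp, rfl⟩ _ ⟨⟨x', y'⟩, hp', rfl⟩ hxx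
    change h x = h x' at hxx
    rw [hh _ _ hp, hh _ _ hp'] at hxx
    subst hxx
    exact hf' _ _ _ hp hp'
  · intro x
    by_cases hex : ∃ y, (x, y) ∈ H
    · obtain ⟨y, hy⟩ := hex
      rw [hh x y hy]
      exact hHR _ _ hy
    · rw [hnot x hex]

/-- A sequence of Borel maps that enumerates the classes of `R`, each pair of related points being
realized by a map on a Borel set on which it is injective. -/
structure ClassEnumeration {X : Type*} [MeasurableSpace X] (R : Setoid X) where
  /-- the maps -/
  map : ℕ → X → X
  /-- sets of injectivity -/
  dom : ℕ → Set X
  measurable_map : ∀ n, Measurable (map n)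
  measurableSet_dom : ∀ n, MeasurableSet (dom n)
  injOn : ∀ n, InjOn (map n) (dom n)
  rel : ∀ n x, R x (map n x)
  exists_map_eq : ∀ x y, R x y → ∃ n, x ∈ dom n ∧ map n x = y
  map_zero : ∀ x, map 0 x = x
  dom_zero : dom 0 = univ

theorem nonempty_classEnumeration {X : Type*} [MeasurableSpace X] [StandardBorelSpace X]
    {R : Setoid X} (hR : IsBorelRel R) (hRc : HasCountableClasses R) :
    Nonempty (ClassEnumeration R) := by
  obtain ⟨G, hG, hcov⟩ := MeasurableSet.exists_countable_cover_isFunctionalGraph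
    (P := {p : X × X | R p.1 p.2}) hR hRc
  -- Intersecting with a transposed graph makes the horizontal sections functional too, which gives
  -- injectivity.
  let H : ℕ → Set (X × X) := fun n =>
    {p | R p.1 p.2} ∩ (G n.unpair.1 ∩ Prod.swap ⁻¹' G n.unpair.2)
  choose h D hh hD hinj hrel hex using fun n => exists_measurable_of_isFunctionalGraph R (H := H n)
    (MeasurableSet.inter hR ((hG _).1.inter (measurable_swap (hG _).1)))
    (fun x y y' h1 h2 => (hG _).2 _ _ _ h1.2.1 h2.2.1)
    (fun x x' y h1 h2 => (hG _).2 _ _ _ h1.2.2 h2.2.2) (fun x y hxy => hxy.1)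
  -- Index `0` is reserved for the identity. As `sInf ∅ = 0`, a least-index choice without
  -- candidates then returns the point itself.
  refine ⟨⟨fun n => n.casesOn id h, fun n => n.casesOn univ D, ?_, ?_, ?_, ?_, ?_, fun _ => rfl,
    rfl⟩⟩
  · rintro (_ | n)
    exacts [measurable_id, hh n]
  · rintro (_ | n)
    exacts [MeasurableSet.univ, hD n]
  · rintro (_ | n)
    exacts [injOn_id _, hinj n]
  · rintro (_ | n) x
    exacts [R.refl x, hrel n x]
  · intro x y hxy
    obtain ⟨n, hn⟩ := mem_iUnion.1 (hcov (show (x, y) ∈ {p : X × X | R p.1 p.2} from hxy))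
    obtain ⟨m, hm⟩ := mem_iUnion.1 (hcov (show (y, x) ∈ {p : X × X | R p.1 p.2} from R.symm hxy))
    exact ⟨Nat.pair n m + 1, hex (Nat.pair n m) x y ⟨hxy, by simpa using hn, by simpa using hm⟩⟩

/-! ### Free products and forests through potentials -/

section Potential

variable {X J : Type*}

/-- There is a path from `x` to `y` along which the increments of the functions `f j`, taken over
the `E j`-steps, add up to `s`. -/
inductive PathSum (E : J → Setoid X) (f : J → X → ℤ) : X → X → ℤ → Prop
  | refl (x) : PathSum E f x x 0
  | step (j x y) : E j x y → PathSum E f x y (f j y - f j x)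
  | symm (x y s) : PathSum E f x y s → PathSum E f y x (-s)
  | trans (x y z s t) : PathSum E f x y s → PathSum E f y z t → PathSum E f x z (s + t)

/-- As `PathSum`, with reduced paths; the last argument is the index of the first step. -/
inductive ReducedPathSum (E : J → Setoid X) (f : J → X → ℤ) : X → X → ℤ → Option J → Prop
  | nil (x) : ReducedPathSum E f x x 0 none
  | cons (j x y z s o) : E j x y → x ≠ y → ReducedPathSum E f y z s o → o ≠ some j →
      ReducedPathSum E f x z (f j y - f j x + s) (some j)

variable {E : J → Setoid X} {f : J → X → ℤ}

/-- A trivial step is dropped, a step with a new index is put in front, and a step with the index of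
the first one is merged with it, possibly cancelling. The increments of `f j` telescope, so the sum
is unchanged. -/
theorem ReducedPathSum.exists_step {j : J} {x y z : X} {s : ℤ} {o : Option J} (hxy : E j x y)
    (h : ReducedPathSum E f y z s o) : ∃ o', ReducedPathSum E f x z (f j y - f j x + s) o' := by
  by_cases hne : x = y
  · subst hne
    exact ⟨o, by simpa using h⟩
  by_cases ho : o = some j
  · subst ho
    cases h with
    | cons _ _ y' _ s' o' hy hyne h' ho' =>
      by_cases hx : x = y'
      · subst hx
        refine ⟨o', ?_⟩
        convert! h' using 1
        ring
      · refine ⟨some j, ?_⟩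
        convert! ReducedPathSum.cons j x y' z s' o' ((E j).trans hxy hy) hx h' ho' using 1
        ring
  · exact ⟨_, ReducedPathSum.cons j x y z s o hxy hne h ho⟩

/-- The two directions are carried through the induction together because reversing a path exchanges
them. -/
theorem PathSum.exists_reducedPathSum_append {x y : X} {s : ℤ} (h : PathSum E f x y s) :
    (∀ z t o, ReducedPathSum E f y z t o → ∃ o', ReducedPathSum E f x z (s + t) o') ∧
      ∀ z t o, ReducedPathSum E f x z t o → ∃ o', ReducedPathSum E f y z (-s + t) o' := by
  induction h with
  | refl x => exact ⟨fun z t o h => ⟨o, by simpa using h⟩, fun z t o h => ⟨o, by simpa using h⟩⟩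
  | step j x y hxy =>
    refine ⟨fun z t o h => h.exists_step hxy, fun z t o h => ?_⟩
    rw [neg_sub]
    exact h.exists_step ((E j).symm hxy)
  | symm x y s _ ih => exact ⟨ih.2, by rw [neg_neg]; exact ih.1⟩
  | trans x y z s t _ _ ih1 ih2 =>
    constructor
    · intro w r o h
      obtain ⟨o1, h1⟩ := ih2.1 w r o h
      obtain ⟨o2, h2⟩ := ih1.1 w _ o1 h1
      exact ⟨o2, by rwa [add_assoc]⟩
    · intro w r o h
      obtain ⟨o1, h1⟩ := ih1.2 w r o h
      obtain ⟨o2, h2⟩ := ih2.2 w _ o1 h1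
      exact ⟨o2, by rwa [neg_add_rev, add_assoc]⟩

theorem ReducedPathSum.exists_path {x y : X} {s : ℤ} {o : Option J}
    (h : ReducedPathSum E f x y s o) (j₀ : J) :
    ∃ (n : ℕ) (p : ℕ → X) (c : ℕ → J), p 0 = x ∧ p n = y ∧ (n = 0 → s = 0) ∧
      (1 ≤ n → o = some (c 0)) ∧ (∀ k < n, E (c k) (p k) (p (k + 1))) ∧
      (∀ k, k + 1 < n → c k ≠ c (k + 1)) ∧ ∀ k < n, p k ≠ p (k + 1) := by
  induction h with
  | nil x => exact ⟨0, fun _ => x, fun _ => j₀, rfl, rfl, by simp, by simp, by simp, by simp,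
      by simp⟩
  | cons j x y z s o hxy hne _ ho ih =>
    obtain ⟨n, p, c, h0, hn, -, h1, hE, hc, hp⟩ := ih
    refine ⟨n + 1, fun k => k.casesOn x p, fun k => k.casesOn j c, rfl, hn, by simp, by simp,
      ?_, ?_, ?_⟩
    · rintro (_ | k) hk
      · simpa [h0] using hxy
      · exact hE k (by omega)
    · rintro (_ | k) hk
      · intro hj
        exact ho ((h1 (by omega)).trans (congrArg some hj.symm))
      · exact hc k (by omega)
    · rintro (_ | k) hk
      · simpa [h0] using hne
      · exact hp k (by omega)

/-- Reduction preserves the sum, and freeness leaves only the empty reduced closed path. -/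
theorem IsFreeProduct.pathSum_self {R : Setoid X} (hR : IsFreeProduct R fun j x y => E j x y)
    {x : X} {s : ℤ} (h : PathSum E f x x s) : s = 0 := by
  obtain ⟨o, ho⟩ := h.exists_reducedPathSum_append.1 x 0 none (ReducedPathSum.nil x)
  rw [add_zero] at ho
  cases ho with
  | nil => rfl
  | cons j _ y _ s o hxy hne h' ho' =>
    obtain ⟨n, p, c, h0, hn, hs, -, hE, hc, hp⟩ :=
      (ReducedPathSum.cons j x y x s o hxy hne h' ho').exists_path j
    rcases Nat.eq_zero_or_pos n with hn0 | hn0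
    · exact hs hn0
    · obtain ⟨k, hk, hk'⟩ := hR.2 n p c hn0 hE hc (hn.trans h0.symm)
      exact (hp k hk hk').elim

/-- In a free product, coboundaries on the factors come from a single function. -/
theorem IsFreeProduct.exists_potential {R : Setoid X} (hR : IsFreeProduct R fun j x y => E j x y)
    (f : J → X → ℤ) : ∃ u : X → ℤ, ∀ j x y, E j x y → u x - f j x = u y - f j y := by
  have hgen : ∀ x y, R x y → ∃ s, PathSum E f x y s := by
    intro x y hxy
    replace hxy := (hR.1 x y).1 hxy
    induction hxy with
    | rel x y h => obtain ⟨j, hj⟩ := h; exact ⟨_, .step j x y hj⟩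
    | refl x => exact ⟨0, .refl x⟩
    | symm x y _ ih => obtain ⟨s, hs⟩ := ih; exact ⟨_, .symm _ _ _ hs⟩
    | trans x y z _ _ ih1 ih2 =>
      obtain ⟨s, hs⟩ := ih1
      obtain ⟨t, ht⟩ := ih2
      exact ⟨_, .trans _ _ _ _ _ hs ht⟩
  -- The potential is the path sum from a chosen representative of the class; `pathSum_self` makes
  -- it independent of the path.
  have hout : ∀ x, R (Quotient.out (Quotient.mk R x)) x := fun x => Quotient.mk_out x
  choose u hu using fun x => hgen _ _ (hout x)
  refine ⟨u, fun j x y hxy => ?_⟩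
  have hRxy : R x y := (hR.1 x y).2 (.rel _ _ ⟨j, hxy⟩)
  have hy := hu y
  rw [← Quotient.sound hRxy] at hy
  have := hR.pathSum_self (.trans _ _ _ _ _ (.trans _ _ _ _ _ (hu x) (.step j x y hxy))
    (.symm _ _ _ hy))
  linarith

/-- The converse of `IsFreeProduct.exists_potential`, with functions for one class at a time. -/
theorem IsFreeProduct.of_exists_potential {S : Setoid X} {E : J → X → X → Prop}
    (hgen : ∀ x y : X, S x y ↔ Relation.EqvGen (fun a b => ∃ j, E j a b) x y)
    (hpot : ∀ (a : X) (f : J → X → ℤ),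
      ∃ u : X → ℤ, ∀ j x y, S a x → E j x y → u x - f j x = u y - f j y) :
    IsFreeProduct S E := by
  classical
  refine ⟨hgen, fun n => ?_⟩
  induction n using Nat.strong_induction_on with
  | _ n ih =>
  intro x c hn hE hc hx
  by_contra! hne
  -- By minimality of `n`, the points of the closed path are distinct except for its two ends.
  have hdist : ∀ p q, p < q → q ≤ n → q - p < n → x p ≠ x q := by
    intro p q hpq hq hlt hpq'
    obtain ⟨k, hk, hk'⟩ := ih (q - p) hlt (fun k => x (p + k)) (fun k => c (p + k)) (by omega)
      (fun k hk => hE (p + k) (by omega)) (fun k hk => hc (p + k) (by omega))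
      (by simpa [Nat.add_sub_cancel' hpq.le] using hpq'.symm)
    exact hne (p + k) (by omega) hk'
  have hS : ∀ k ≤ n, S (x 0) (x k) := by
    intro k hk
    induction k with
    | zero => exact S.refl _
    | succ k ihk =>
      exact S.trans (ihk (by omega)) ((hgen _ _).2 (.rel _ _ ⟨_, hE k (by omega)⟩))
  -- This function jumps by one on the first step only: the second step also touches `x 1` but has
  -- another index, and later steps avoid `x 1`. Hence `u` cannot close up.
  obtain ⟨u, hu⟩ := hpot (x 0) fun j z => if j = c 0 ∧ z = x 1 then 1 else 0
  have hstep : ∀ k < n, _ := fun k hk => hu (c k) (x k) (x (k + 1)) (hS k hk.le) (hE k hk)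
  have h0 := hstep 0 hn
  have hn2 : 2 ≤ n := by
    by_contra hcon
    obtain rfl : n = 1 := by omega
    exact hne 0 hn hx.symm
  have hconst : ∀ k, 1 ≤ k → k ≤ n → u (x k) = u (x 1) := by
    intro k hk1 hkn
    induction k, hk1 using Nat.le_induction with
    | base => rfl
    | succ k hk1 ihk =>
      rw [← ihk (by omega)]
      have := hstep k (by omega)
      rw [if_neg, if_neg] at this
      · linarith
      · rintro ⟨-, h⟩
        exact hdist 1 (k + 1) (by omega) hkn (by omega) h.symm
      · rintro ⟨h, h'⟩
        rcases eq_or_lt_of_le hk1 with rfl | hk1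
        · exact hc 0 (by omega) h.symm
        · exact hdist 1 k hk1 (by omega) (by omega) h'.symm
  have := hconst n (by omega) le_rfl
  rw [hx] at this
  rw [if_neg (fun h => hne 0 hn h.2), if_pos ⟨rfl, rfl⟩, this] at h0
  linarith

/-- A graph all of whose antisymmetric edge functions have a potential is a forest. -/
theorem SimpleGraph.isAcyclic_of_exists_potential {S : Setoid X} {G : SimpleGraph X}
    (hGS : ∀ x y, G.Adj x y → S x y)
    (hpot : ∀ (a : X) (c : X → X → ℤ), (∀ x y, c y x = - c x y) →
      ∃ u : X → ℤ, ∀ x y, S a x → G.Adj x y → u x - u y = c x y) : G.IsAcyclic := by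
  classical
  rw [SimpleGraph.isAcyclic_iff_forall_adj_isBridge]
  intro v w hvw
  rw [SimpleGraph.isBridge_iff]
  refine fun hreach => ?_
  have hne := hvw.ne
  -- A unit increment across the edge `v w` alone: `u` is constant along paths avoiding the edge,
  -- yet differs at its ends.
  obtain ⟨u, hu⟩ := hpot v (fun x y => (if x = v ∧ y = w then 1 else 0) -
    (if x = w ∧ y = v then 1 else 0)) (fun x y => by simp only [and_comm]; ring)
  have hconst : ∀ z, (G \ SimpleGraph.fromEdgeSet {s(v, w)}).Reachable v z → S v z ∧ u z = u v := by
    intro z hz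
    rw [SimpleGraph.reachable_iff_reflTransGen] at hz
    induction hz with
    | refl => exact ⟨S.refl _, rfl⟩
    | tail _ h ih =>
      rw [SimpleGraph.sdiff_adj, SimpleGraph.fromEdgeSet_adj] at h
      have := hu _ _ ih.1 h.1
      have hn : ¬ s(_, _) ∈ ({s(v, w)} : Set (Sym2 X)) := fun hm => h.2 ⟨hm, h.1.ne⟩
      rw [Set.mem_singleton_iff, Sym2.eq_iff] at hn
      push Not at hn
      rw [if_neg (fun hh => hn.1 hh.1 hh.2), if_neg (fun hh => hn.2 hh.1 hh.2)] at this
      exact ⟨S.trans ih.1 (hGS _ _ h.1), by linarith [ih.2]⟩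
  have h1 := hu v w (S.refl v) hvw
  simp [hne] at h1
  have := (hconst w hreach).2
  omega

end Potential


/-! ### Heights, roots and base points -/

section Heights

variable {X I : Type*}

/-- `y` has minimal height `d` in its `E i`-class. -/
def IsLowest (E : I → Setoid X) (d : X → ℕ) (i : I) (y : X) : Prop :=
  ∀ y', E i y y' → d y ≤ d y'

theorem exists_isLowest (E : I → Setoid X) (d : X → ℕ) (i : I) (y : X) :
    ∃ y', E i y y' ∧ IsLowest E d i y' := by
  classical
  have hex : ∃ n y', E i y y' ∧ d y' = n := ⟨d y, y, (E i).refl y, rfl⟩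
  obtain ⟨y', hy', hn⟩ := Nat.find_spec hex
  refine ⟨y', hy', fun z hz => ?_⟩
  rw [hn]
  exact Nat.find_min' hex ⟨z, (E i).trans hy' hz, rfl⟩

namespace ClassEnumeration

variable [MeasurableSpace X] {R : Setoid X} (e : ClassEnumeration R) (E : I → Setoid X) (d : X → ℕ)

/-- The first lowest point in the `E i`-class of `y`. -/
noncomputable def toLowest (i : I) (y : X) : X :=
  e.map (sInf {m | E i y (e.map m y) ∧ IsLowest E d i (e.map m y)}) y

/-- The first point that is lowest in a class in which `y` is not, or `y` if there is none. -/
noncomputable def parent (y : X) : X :=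
  e.map (sInf {m | ∃ i, E i y (e.map m y) ∧ IsLowest E d i (e.map m y) ∧ ¬ IsLowest E d i y}) y

/-- The last ancestor of `y`. -/
noncomputable def root (y : X) : X := (e.parent E d)^[d y] y

/-- The first index of a map that leads injectively from the root of `y` to `y`. -/
noncomputable def rootIndex (y : X) : ℕ :=
  sInf {n | e.root E d y ∈ e.dom n ∧ e.map n (e.root E d y) = y}

/-- `y` is lowest in its `E i`-class, with least index among the lowest points. -/
def IsBase (i : I) (y : X) : Prop :=
  IsLowest E d i y ∧ ∀ y', E i y y' → IsLowest E d i y' → e.rootIndex E d y ≤ e.rootIndex E d y'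

/-- The first base point in the `E i`-class of `y`. -/
noncomputable def toBase (i : I) (y : X) : X :=
  e.map (sInf {m | E i y (e.map m y) ∧ e.IsBase E d i (e.map m y)}) y

variable {E d}

theorem toLowest_spec (hE : ∀ i x y, E i x y → R x y) (i : I) (y : X) :
    E i y (e.toLowest E d i y) ∧ IsLowest E d i (e.toLowest E d i y) := by
  refine Nat.sInf_mem (s := {m | E i y (e.map m y) ∧ IsLowest E d i (e.map m y)}) ?_
  obtain ⟨y', hy, hy'⟩ := exists_isLowest E d i y
  obtain ⟨n, -, rfl⟩ := e.exists_map_eq _ _ (hE i _ _ hy)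
  exact ⟨n, hy, hy'⟩

theorem toLowest_eq {i : I} {y : X} (h : IsLowest E d i y) : e.toLowest E d i y = y := by
  have : sInf {m | E i y (e.map m y) ∧ IsLowest E d i (e.map m y)} = 0 :=
    Nat.sInf_eq_zero.2 (Or.inl ⟨by rw [e.map_zero], by rwa [e.map_zero]⟩)
  rw [toLowest, this, e.map_zero]

theorem parent_eq_self {y : X} (h : ∀ i, IsLowest E d i y) : e.parent E d y = y := by
  have : {m | ∃ i, E i y (e.map m y) ∧ IsLowest E d i (e.map m y) ∧ ¬ IsLowest E d i y} = ∅ :=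
    eq_empty_of_forall_notMem fun m ⟨i, _, _, hi⟩ => hi (h i)
  rw [parent, this, Nat.sInf_empty, e.map_zero]

/-- The least index over all `i` together is also the least for an `i` that attains it. So passing
to the parent is one of the moves to a lowest point, to which edge conditions apply. -/
theorem parent_eq_toLowest (hE : ∀ i x y, E i x y → R x y) {y : X}
    (h : ∃ i, ¬ IsLowest E d i y) :
    ∃ i, e.parent E d y = e.toLowest E d i y ∧ d (e.parent E d y) < d y := by
  set s := {m | ∃ i, E i y (e.map m y) ∧ IsLowest E d i (e.map m y) ∧ ¬ IsLowest E d i y} with hs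
  have hmem : ∀ i, ¬ IsLowest E d i y →
      sInf {m | E i y (e.map m y) ∧ IsLowest E d i (e.map m y)} ∈ s := fun i hi =>
    ⟨i, (e.toLowest_spec hE i y).1, (e.toLowest_spec hE i y).2, hi⟩
  obtain ⟨i₀, hi₀⟩ := h
  obtain ⟨i, h1, h2, h3⟩ := Nat.sInf_mem ⟨_, hmem i₀ hi₀⟩
  have heq : sInf s = sInf {m | E i y (e.map m y) ∧ IsLowest E d i (e.map m y)} :=
    le_antisymm (Nat.sInf_le (hmem i h3)) (Nat.sInf_le ⟨h1, h2⟩)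
  refine ⟨i, ?_, ?_⟩
  · rw [parent, toLowest, ← hs, heq]
  · change d (e.map (sInf s) y) < d y
    by_contra hcon
    exact h3 fun z hz => (not_lt.1 hcon).trans (h2 z ((E i).trans ((E i).symm h1) hz))

theorem rel_parent (y : X) : R y (e.parent E d y) := e.rel _ _

theorem rel_root (y : X) : R y (e.root E d y) := by
  rw [root]
  generalize d y = n
  induction n with
  | zero => exact R.refl y
  | succ n ih => rw [Function.iterate_succ_apply']; exact R.trans ih (e.rel_parent _)

section

variable (hE : ∀ i x y, E i x y → R x y) (hd : ∀ y, 0 < d y → ∃ i, ¬ IsLowest E d i y)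
include hE hd

theorem height_iterate_parent (n : ℕ) (y : X) (hn : d y ≤ n) :
    d ((e.parent E d)^[n] y) = 0 := by
  induction n generalizing y with
  | zero => exact Nat.le_zero.1 hn
  | succ n ih =>
    rw [Function.iterate_succ_apply]
    apply ih
    by_cases h : ∀ i, IsLowest E d i y
    · have : d y = 0 := by
        by_contra h0
        obtain ⟨i, hi⟩ := hd y (Nat.pos_of_ne_zero h0)
        exact hi (h i)
      rw [e.parent_eq_self h, this]
      exact Nat.zero_le _
    · push Not at h
      obtain ⟨i, -, hlt⟩ := e.parent_eq_toLowest hE h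
      omega

theorem height_root (y : X) : d (e.root E d y) = 0 :=
  e.height_iterate_parent hE hd _ _ le_rfl

omit hE hd in
theorem parent_eq_self_of_height {y : X} (h : d y = 0) : e.parent E d y = y :=
  e.parent_eq_self fun _ _ _ => h ▸ Nat.zero_le _

omit hE hd in
theorem root_eq_self {y : X} (h : d y = 0) : e.root E d y = y := by rw [root, h]; rfl

/-- The height may drop by more than one; the surplus iterations in the root of `y` do nothing,
since points of height zero are their own parents. -/
theorem root_parent (y : X) : e.root E d (e.parent E d y) = e.root E d y := by
  by_cases h : ∀ i, IsLowest E d i y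
  · rw [e.parent_eq_self h]
  push Not at h
  obtain ⟨i, -, hlt⟩ := e.parent_eq_toLowest hE h
  obtain ⟨m, hm⟩ := Nat.exists_eq_add_of_lt hlt
  have hr : e.root E d y = (e.parent E d)^[m] (e.root E d (e.parent E d y)) := by
    rw [root, root, ← Function.iterate_add_apply, ← Function.iterate_succ_apply]
    congr 1
    omega
  rw [hr, Function.iterate_fixed
    (e.parent_eq_self_of_height (e.height_root hE hd (e.parent E d y)))]

omit hE hd in
theorem rootIndex_spec (y : X) : e.root E d y ∈ e.dom (e.rootIndex E d y) ∧
    e.map (e.rootIndex E d y) (e.root E d y) = y :=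
  Nat.sInf_mem (e.exists_map_eq _ _ (R.symm (e.rel_root y)))

omit hE hd in
theorem rootIndex_eq_zero {y : X} (h : d y = 0) : e.rootIndex E d y = 0 := by
  refine Nat.sInf_eq_zero.2 (Or.inl ⟨by rw [e.dom_zero]; trivial, ?_⟩)
  rw [e.map_zero, e.root_eq_self h]

omit hE hd in
theorem isBase_of_height {y : X} (h : d y = 0) (i : I) : e.IsBase E d i y :=
  ⟨fun _ _ => h ▸ Nat.zero_le _, fun _ _ _ => (e.rootIndex_eq_zero h).symm ▸ Nat.zero_le _⟩

omit hE hd in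
theorem exists_isBase (i : I) (y : X) : ∃ y', E i y y' ∧ e.IsBase E d i y' := by
  classical
  obtain ⟨y₀, h₀, h₀'⟩ := exists_isLowest E d i y
  have hex : ∃ n y', E i y y' ∧ IsLowest E d i y' ∧ e.rootIndex E d y' = n :=
    ⟨_, y₀, h₀, h₀', rfl⟩
  obtain ⟨y', hy', hl, hn⟩ := Nat.find_spec hex
  refine ⟨y', hy', hl, fun z hz hzl => ?_⟩
  rw [hn]
  exact Nat.find_min' hex ⟨z, (E i).trans hy' hz, hzl, rfl⟩

omit hd in
theorem toBase_spec (i : I) (y : X) :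
    E i y (e.toBase E d i y) ∧ e.IsBase E d i (e.toBase E d i y) := by
  refine Nat.sInf_mem (s := {m | E i y (e.map m y) ∧ e.IsBase E d i (e.map m y)}) ?_
  obtain ⟨y', hy, hy'⟩ := e.exists_isBase (d := d) i y
  obtain ⟨n, -, rfl⟩ := e.exists_map_eq _ _ (hE i _ _ hy)
  exact ⟨n, hy, hy'⟩

omit hE hd in
theorem toBase_eq {i : I} {y : X} (h : e.IsBase E d i y) : e.toBase E d i y = y := by
  have : sInf {m | E i y (e.map m y) ∧ e.IsBase E d i (e.map m y)} = 0 :=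
    Nat.sInf_eq_zero.2 (Or.inl ⟨by rw [e.map_zero], by rwa [e.map_zero]⟩)
  rw [toBase, this, e.map_zero]

omit hE hd in
-- This makes a single map of the enumeration serve all base points of a class.
theorem rootIndex_eq_of_isBase {i : I} {y y' : X} (hyy : E i y y') (h : e.IsBase E d i y)
    (h' : e.IsBase E d i y') : e.rootIndex E d y = e.rootIndex E d y' :=
  le_antisymm (h.2 _ hyy h'.1) (h'.2 _ ((E i).symm hyy) h.1)

/-- Prescribed increments on the images of the base points and of the edges that lead from a point
to a base point of its class are realized by a function on the roots. -/
theorem exists_root_potential (hfree : IsFreeProduct R fun i x y => E i x y)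
    (F : I → ℕ → X → ℤ) (c : X → X → ℤ) (hc : ∀ x y, c y x = - c x y) :
    ∃ u : X → ℤ,
      (∀ i y y', E i y y' → e.IsBase E d i y → e.IsBase E d i y' →
        u (e.root E d y) - F i (e.rootIndex E d y) (e.root E d y) =
          u (e.root E d y') - F i (e.rootIndex E d y') (e.root E d y')) ∧
      (∀ i y, u (e.root E d y) - u (e.root E d (e.toLowest E d i y)) =
        c (e.root E d y) (e.root E d (e.toLowest E d i y))) ∧
      ∀ i y, IsLowest E d i y → u (e.root E d y) - u (e.root E d (e.toBase E d i y)) =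
        c (e.root E d y) (e.root E d (e.toBase E d i y)) := by
  set r := e.root E d with hr
  set p := e.toLowest E d with hp
  set q := e.toBase E d with hq
  have hcc : ∀ x, c x x = 0 := fun x => by have := hc x x; omega
  -- The value of `F` at the base point, plus the increments prescribed on the two edges leading
  -- from `y` through the lowest point to it, all read at roots.
  let f : I → X → ℤ := fun i y =>
    F i (e.rootIndex E d (q i (p i y))) (r (q i (p i y))) + c (r (p i y)) (r (q i (p i y))) +
      c (r y) (r (p i y))
  obtain ⟨u, hu⟩ := hfree.exists_potential f
  have hlow : ∀ i y, IsLowest E d i y →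
      f i y = F i (e.rootIndex E d (q i y)) (r (q i y)) + c (r y) (r (q i y)) := by
    intro i y h
    have : p i y = y := e.toLowest_eq h
    simp only [f, this, hcc, add_zero]
  have hbase : ∀ i y, e.IsBase E d i y → f i y = F i (e.rootIndex E d y) (r y) := by
    intro i y h
    have : q i y = y := e.toBase_eq h
    rw [hlow i y h.1, this, hcc, add_zero]
  have hup : ∀ i y, u y - u (p i y) = c (r y) (r (p i y)) := by
    intro i y
    have h := hu i _ _ (e.toLowest_spec (d := d) hE i y).1
    have h' := hlow i _ (e.toLowest_spec (d := d) hE i y).2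
    change f i (p i y) = _ at h'
    change u y - f i y = u (p i y) - f i (p i y) at h
    rw [h'] at h
    simp only [f] at h
    linarith
  -- The parent has the same root, so the increment prescribed between the roots is `c x x = 0`.
  have hupar : ∀ y, u (e.parent E d y) = u y := by
    intro y
    by_cases h : ∀ i, IsLowest E d i y
    · rw [e.parent_eq_self h]
    · push Not at h
      obtain ⟨i, hi, -⟩ := e.parent_eq_toLowest hE h
      have h1 := hup i y
      have h2 := e.root_parent hE hd y
      rw [hi] at h2 ⊢
      change r (p i y) = r y at h2
      rw [h2, hcc] at h1
      change u (p i y) = u y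
      omega
  have hur : ∀ y, u (r y) = u y := by
    intro y
    rw [hr, root]
    generalize d y = n
    induction n with
    | zero => rfl
    | succ n ih => rw [Function.iterate_succ_apply', hupar, ih]
  refine ⟨u, fun i y y' hyy h h' => ?_, fun i y => ?_, fun i y h => ?_⟩
  · rw [hur, hur, ← hbase i y h, ← hbase i y' h']
    exact hu i y y' hyy
  · rw [hur, hur]
    exact hup i y
  · rw [hur, hur]
    have hs := e.toBase_spec (d := d) hE i y
    have h1 := hu i _ _ hs.1
    rw [hlow i y h, hbase i _ hs.2] at h1
    change u y - _ = u (q i y) - F i (e.rootIndex E d (q i y)) (r (q i y)) at h1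
    linarith

end

end ClassEnumeration

end Heights

/-! ### Distance to an `S`-class as the height -/

section ClassDistance

variable {X I : Type*} (E : I → Setoid X) (S : Setoid X)

/-- `y` is at most `n` steps in the relations `E i` away from the `S`-class of `a`. -/
def StepsToClass : ℕ → X → X → Prop
  | 0, a, y => S a y
  | n + 1, a, y => ∃ i y', E i y y' ∧ StepsToClass n a y'

/-- The number of steps from `y` to the `S`-class of `a`, or zero if it cannot be reached. -/
noncomputable def classDist (a y : X) : ℕ := sInf {n | StepsToClass E S n a y}

variable {E S}

/-- Lets each point of an `S`-class measure heights from itself, with the same result. -/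
theorem classDist_congr {a a' : X} (h : S a a') : classDist E S a = classDist E S a' := by
  have : ∀ n y, StepsToClass E S n a y ↔ StepsToClass E S n a' y := by
    intro n
    induction n with
    | zero => exact fun y => ⟨fun hy => S.trans (S.symm h) hy, fun hy => S.trans h hy⟩
    | succ n ih => intro y; simp only [StepsToClass, ih]
  funext y
  simp only [classDist, this]

theorem classDist_eq_zero {a y : X} (h : S a y) : classDist E S a y = 0 :=
  Nat.sInf_eq_zero.2 (Or.inl h)

/-- The first step of a shortest path to the class leads to a lower point. -/
theorem exists_not_isLowest_of_classDist_pos (a y : X) (h : 0 < classDist E S a y) :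
    ∃ i, ¬ IsLowest E (classDist E S a) i y := by
  have hmem := Nat.sInf_mem (Nat.nonempty_of_pos_sInf h)
  change StepsToClass E S (classDist E S a y) a y at hmem
  obtain ⟨n, hn⟩ := Nat.exists_eq_succ_of_ne_zero h.ne'
  rw [hn] at hmem
  obtain ⟨i, y', hy, hy'⟩ := hmem
  refine ⟨i, fun hl => ?_⟩
  have h1 := hl y' hy
  have h2 : classDist E S a y' ≤ n := Nat.sInf_le hy'
  omega

/-- Within the `R`-class the `S`-class is reachable, so the value zero is not the default of `sInf
∅`. -/
theorem rel_of_classDist_eq_zero {R : Setoid X} (hfree : IsFreeProduct R fun i x y => E i x y)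
    {a y : X} (hay : R a y) (h : classDist E S a y = 0) : S a y := by
  have hex : ∀ x y, Relation.EqvGen (fun x y => ∃ i, E i x y) x y →
      ((∃ n, StepsToClass E S n a x) ↔ ∃ n, StepsToClass E S n a y) := by
    intro x y hxy
    induction hxy with
    | rel x y h =>
      obtain ⟨i, hi⟩ := h
      exact ⟨fun ⟨n, hn⟩ => ⟨n + 1, i, x, (E i).symm hi, hn⟩, fun ⟨n, hn⟩ => ⟨n + 1, i, y, hi, hn⟩⟩
    | refl => exact Iff.rfl
    | symm _ _ _ ih => exact ih.symm
    | trans _ _ _ _ _ ih1 ih2 => exact ih1.trans ih2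
  have hne : {n | StepsToClass E S n a y}.Nonempty :=
    (hex a y ((hfree.1 a y).1 hay)).1 ⟨0, S.refl a⟩
  have := Nat.sInf_mem hne
  change StepsToClass E S (classDist E S a y) a y at this
  rwa [h] at this

end ClassDistance


theorem IsFreeProduct.rel {X I : Type*} {R : Setoid X} {E : I → Setoid X}
    (hfree : IsFreeProduct R fun i x y => E i x y) (i : I) (x y : X) (h : E i x y) : R x y :=
  (hfree.1 x y).2 (.rel _ _ ⟨i, h⟩)

/-! ### The factors and the forest -/

section KuroshData

variable {X I : Type*} [MeasurableSpace X] {R : Setoid X} (e : ClassEnumeration R)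
  (E : I → Setoid X) (S : Setoid X)

/-- A map as a partial equivalence from a set on which it is injective onto the image. -/
noncomputable def Set.InjOn.partialEquivImage {f : X → X} {A : Set X} (hf : InjOn f A) :
    PartialEquiv X X := by
  classical exact
  { toFun := f
    invFun := fun y => if h : ∃ x ∈ A, f x = y then h.choose else y
    source := A
    target := f '' A
    map_source' := fun x hx => ⟨x, hx, rfl⟩
    map_target' := fun y hy => by
      have h : ∃ x ∈ A, f x = y := hy
      rw [dif_pos h]
      exact h.choose_spec.1
    left_inv' := fun x hx => by
      have h : ∃ x' ∈ A, f x' = f x := ⟨x, hx, rfl⟩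
      rw [dif_pos h]
      exact hf h.choose_spec.1 hx h.choose_spec.2
    right_inv' := fun y hy => by
      have h : ∃ x ∈ A, f x = y := hy
      rw [dif_pos h]
      exact h.choose_spec.2 }

theorem Set.InjOn.partialEquivImage_mem_fullPseudogroup [StandardBorelSpace X] {f : X → X}
    {A : Set X} (hf : InjOn f A) (hfm : Measurable f) (hA : MeasurableSet A)
    (hR : ∀ x, R x (f x)) : hf.partialEquivImage ∈ fullPseudogroup R := by
  refine ⟨hA, hA.image_of_measurable_injOn hfm hf, hfm.comp measurable_subtype_coe, ?_,
    fun x _ => hR x⟩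
  intro U hU
  refine ⟨f '' (A ∩ U), (hA.inter hU).image_of_measurable_injOn hfm (hf.mono inter_subset_left), ?_⟩
  ext ⟨_, x, hx, rfl⟩
  have hinv : hf.partialEquivImage.symm (f x) = x := hf.partialEquivImage.left_inv hx
  simp only [mem_preimage, hinv]
  constructor
  · rintro ⟨x', ⟨hx', hU'⟩, hxx⟩
    rwa [← hf hx' hx hxx]
  · exact fun h => ⟨x, ⟨hx, h⟩, rfl⟩

namespace ClassEnumeration

/-- The points that `e.map k` sends injectively to base points of `E i`-classes. -/
def kuroshDom (i : I) (k : ℕ) : Set X :=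
  {x | e.root E (classDist E S x) (e.map k x) = x ∧
    e.rootIndex E (classDist E S x) (e.map k x) = k ∧ e.IsBase E (classDist E S x) i (e.map k x)}

theorem kuroshDom_subset (i : I) (k : ℕ) : e.kuroshDom E S i k ⊆ e.dom k := by
  intro x hx
  have h := (e.rootIndex_spec (E := E) (d := classDist E S x) (e.map k x)).1
  rwa [hx.1, hx.2.1] at h

/-- The partial isomorphisms of the decomposition. -/
noncomputable def kuroshMap (i : I) (k : ℕ) : PartialEquiv X X :=
  ((e.injOn k).mono (e.kuroshDom_subset E S i k)).partialEquivImage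

/-- Two roots are joined if they come from a point and the lowest or base point chosen for it. -/
def RootEdge (x x' : X) : Prop :=
  S x x' ∧ ∃ i y, R x y ∧ e.root E (classDist E S x) y = x ∧
    (e.root E (classDist E S x) (e.toLowest E (classDist E S x) i y) = x' ∨
      IsLowest E (classDist E S x) i y ∧
        e.root E (classDist E S x) (e.toBase E (classDist E S x) i y) = x')

/-- The graph of the root edges. -/
def rootGraph : SimpleGraph X := SimpleGraph.fromRel (e.RootEdge E S)

variable {E S}

/-- A point of height zero is its own root, has index `0`, and is a base point for every `i`. -/
theorem kuroshDom_zero (i : I) : e.kuroshDom E S i 0 = univ := by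
  refine eq_univ_of_forall fun x => ?_
  have h : classDist E S x x = 0 := classDist_eq_zero (S.refl x)
  simp only [kuroshDom, mem_ofPred_eq, e.map_zero]
  exact ⟨e.root_eq_self h, e.rootIndex_eq_zero h, e.isBase_of_height h i⟩

theorem rel_of_rootGraph_adj {x x' : X} (h : (e.rootGraph E S).Adj x x') : S x x' := by
  rw [rootGraph, SimpleGraph.fromRel_adj] at h
  rcases h.2 with h | h
  · exact h.1
  · exact S.symm h.1

theorem rel_of_rootGraph_reachable {x x' : X} (h : (e.rootGraph E S).Reachable x x') :
    S x x' := by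
  rw [SimpleGraph.reachable_iff_reflTransGen] at h
  induction h with
  | refl => exact S.refl x
  | tail _ h ih => exact S.trans ih (e.rel_of_rootGraph_adj h)

section

variable (hfree : IsFreeProduct R fun i x y => E i x y) (hSR : S ≤ R)
include hfree

theorem rel_root_classDist {a y : X} (hay : R a y) : S a (e.root E (classDist E S a) y) :=
  rel_of_classDist_eq_zero hfree (R.trans hay (e.rel_root y))
    (e.height_root hfree.rel (exists_not_isLowest_of_classDist_pos a) y)

/-- On the `S`-class of `a` all heights agree with those measured from `a`, so the potential on
roots for this one height function serves every factor and edge. -/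
theorem exists_kurosh_potential (a : X) (F : I → ℕ → X → ℤ) (c : X → X → ℤ)
    (hc : ∀ x y, c y x = - c x y) :
    ∃ u : X → ℤ, (∀ i k x x', S a x → kuroshFactor (E i) S (e.kuroshMap E S i k) x x' →
      u x - F i k x = u x' - F i k x') ∧
      ∀ x x', S a x → (e.rootGraph E S).Adj x x' → u x - u x' = c x x' := by
  obtain ⟨u, h1, h2, h3⟩ := e.exists_root_potential hfree.rel
    (exists_not_isLowest_of_classDist_pos (S := S) a) hfree F c hc
  refine ⟨u, ?_, ?_⟩
  · rintro i k x x' hax ⟨⟨hx, hx', -, -, hE⟩, hxx⟩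
    obtain ⟨hr, hi, hb⟩ : x ∈ e.kuroshDom E S i k := hx
    obtain ⟨hr', hi', hb'⟩ : x' ∈ e.kuroshDom E S i k := hx'
    rw [← classDist_congr hax] at hr hi hb
    rw [← classDist_congr (S.trans hax hxx)] at hr' hi' hb'
    have := h1 i (e.map k x) (e.map k x') hE hb hb'
    rwa [hr, hi, hr', hi'] at this
  · have key : ∀ x x', S a x → e.RootEdge E S x x' → u x - u x' = c x x' := by
      rintro x x' hax ⟨-, i, y, -, hr, h⟩
      rw [← classDist_congr hax] at hr h
      rcases h with h | ⟨hl, h⟩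
      · have := h2 i y
        rwa [hr, h] at this
      · have := h3 i y hl
        rwa [hr, h] at this
    intro x x' hax hadj
    have hxx := e.rel_of_rootGraph_adj hadj
    rw [rootGraph, SimpleGraph.fromRel_adj] at hadj
    rcases hadj.2 with h | h
    · exact key x x' hax h
    · have := key x' x (S.trans hax hxx) h
      have := hc x x'
      omega

theorem isAcyclic_rootGraph : (e.rootGraph E S).IsAcyclic :=
  SimpleGraph.isAcyclic_of_exists_potential (fun _ _ => e.rel_of_rootGraph_adj) fun a c hc =>
    (e.exists_kurosh_potential hfree a (fun _ _ _ => 0) c hc).imp fun _ h => h.2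

include hSR

/-- `root` turns a step of a factor of `R` into edges, one step of a factor of `S`, and edges, and
it fixes the `S`-class; this gives generation. For freeness, the function given on `T` is imposed as
increments along edges, which add up along paths. -/
theorem isFreeProduct_kurosh : IsFreeProduct S
    (Sum.elim (fun p : (_ : I) × ℕ => kuroshFactor (E p.1) S (e.kuroshMap E S p.1 p.2))
      (fun (_ : Unit) x y => (e.rootGraph E S).reachableSetoid x y)) := by
  have hT : ∀ x y, (e.rootGraph E S).reachableSetoid x y ↔ (e.rootGraph E S).Reachable x y :=
    fun _ _ => Iff.rfl
  refine IsFreeProduct.of_exists_potential (fun x y => ⟨fun hxy => ?_, fun hxy => ?_⟩) ?_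
  · set C := Relation.EqvGen (fun a b => ∃ j, Sum.elim
      (fun p : (_ : I) × ℕ => kuroshFactor (E p.1) S (e.kuroshMap E S p.1 p.2))
      (fun (_ : Unit) x y => (e.rootGraph E S).reachableSetoid x y) j a b)
    set r := e.root E (classDist E S x) with hr
    have hroot : ∀ y, R x y → S x (r y) := fun y => e.rel_root_classDist hfree
    have hrr : ∀ y, R x y → e.root E (classDist E S (r y)) y = r y := fun y hy => by
      rw [← classDist_congr (hroot y hy)]
    have hRr : ∀ y, R x y → R (r y) y := fun y _ => R.symm (e.rel_root y)
    have hedge : ∀ y y', R x y → R x y' → e.RootEdge E S (r y) (r y') → C (r y) (r y') := by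
      intro y y' hy hy' h
      refine .rel _ _ ⟨Sum.inr (), ?_⟩
      change (e.rootGraph E S).Reachable _ _
      by_cases hne : r y = r y'
      · rw [hne]
      · refine SimpleGraph.Adj.reachable ?_
        rw [rootGraph, SimpleGraph.fromRel_adj]
        exact ⟨hne, Or.inl h⟩
    have hE := hfree.rel
    have hbase : ∀ i y, R x y → ∃ y', E i y y' ∧ e.IsBase E (classDist E S x) i y' ∧
        C (r y) (r y') := by
      intro i y hy
      have hp := e.toLowest_spec (d := classDist E S x) hE i y
      have hq := e.toBase_spec (d := classDist E S x) hE i (e.toLowest E (classDist E S x) i y)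
      have hRp := R.trans hy (hE i _ _ hp.1)
      have hRq := R.trans hRp (hE i _ _ hq.1)
      refine ⟨_, (E i).trans hp.1 hq.1, hq.2, .trans _ _ _
        (hedge y _ hy hRp ⟨S.trans (S.symm (hroot _ hy)) (hroot _ hRp), i, y, hRr y hy, hrr y hy,
          Or.inl ?_⟩)
        (hedge _ _ hRp hRq ⟨S.trans (S.symm (hroot _ hRp)) (hroot _ hRq), i, _, hRr _ hRp,
          hrr _ hRp, Or.inr ⟨?_, ?_⟩⟩)⟩
      · rw [← classDist_congr (hroot y hy)]
      · rw [← classDist_congr (hroot _ hRp)]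
        exact hp.2
      · rw [← classDist_congr (hroot _ hRp)]
    -- Equivalent base points have the same index `k`, so their roots are related by the single
    -- factor with indices `i` and `k`.
    have hfac : ∀ i y y', R x y → E i y y' → e.IsBase E (classDist E S x) i y →
        e.IsBase E (classDist E S x) i y' → C (r y) (r y') := by
      intro i y y' hy hyy hb hb'
      have hy' := R.trans hy (hE i _ _ hyy)
      have hm : ∀ y, R x y → e.IsBase E (classDist E S x) i y →
          e.map (e.rootIndex E (classDist E S x) y) (r y) = y ∧
          r y ∈ e.kuroshDom E S i (e.rootIndex E (classDist E S x) y) := by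
        intro y hy hb
        have h := (e.rootIndex_spec (E := E) (d := classDist E S x) y).2
        rw [← hr] at h
        simp only [kuroshDom, mem_ofPred_eq]
        rw [← classDist_congr (hroot y hy), h]
        exact ⟨rfl, rfl, rfl, hb⟩
      have h := hm y hy hb
      have h' := hm y' hy' hb'
      rw [← e.rootIndex_eq_of_isBase hyy hb hb'] at h'
      refine .rel _ _ ⟨Sum.inl ⟨i, e.rootIndex E (classDist E S x) y⟩, ⟨h.2, h'.2,
        ⟨_, h.2, rfl⟩, ⟨_, h'.2, rfl⟩, ?_⟩, S.trans (S.symm (hroot y hy)) (hroot y' hy')⟩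
      change E i (e.map _ (r y)) (e.map _ (r y'))
      rwa [h.1, h'.1]
    have hall : ∀ y y', Relation.EqvGen (fun a b => ∃ i, E i a b) y y' → R x y →
        C (r y) (r y') := by
      intro y y' h
      induction h with
      | rel y y' h =>
        intro hy
        obtain ⟨i, hi⟩ := h
        obtain ⟨z, hz, hbz, hC⟩ := hbase i y hy
        obtain ⟨z', hz', hbz', hC'⟩ := hbase i y' (R.trans hy (hE i _ _ hi))
        exact .trans _ _ _ hC (.trans _ _ _ (hfac i z z' (R.trans hy (hE i _ _ hz))
          ((E i).trans ((E i).symm hz) ((E i).trans hi hz')) hbz hbz') (.symm _ _ hC'))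
      | refl => exact fun _ => .refl _
      | symm y y' h ih => exact fun hy => .symm _ _ (ih (R.trans hy (R.symm ((hfree.1 _ _).2 h))))
      | trans y y' y'' h _ ih ih' =>
        exact fun hy => .trans _ _ _ (ih hy) (ih' (R.trans hy ((hfree.1 _ _).2 h)))
    have h := hall x y ((hfree.1 x y).1 (hSR hxy)) (R.refl x)
    rwa [hr, e.root_eq_self (classDist_eq_zero (S.refl x)),
      e.root_eq_self (classDist_eq_zero hxy)] at h
  · induction hxy with
    | rel x y h =>
      obtain ⟨j | j, hj⟩ := h
      · exact hj.2
      · exact e.rel_of_rootGraph_reachable hj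
    | refl => exact S.refl _
    | symm _ _ _ ih => exact S.symm ih
    | trans _ _ _ _ _ ih ih' => exact S.trans ih ih'
  · intro a f
    obtain ⟨u, h1, h2⟩ := e.exists_kurosh_potential (S := S) hfree a
      (fun i k => f (Sum.inl ⟨i, k⟩))
      (fun x y => f (Sum.inr ()) x - f (Sum.inr ()) y) (fun x y => by ring)
    refine ⟨u, ?_⟩
    rintro (⟨i, k⟩ | _) x y hax hxy
    · exact h1 i k x y hax hxy
    · change (e.rootGraph E S).Reachable x y at hxy
      rw [SimpleGraph.reachable_iff_reflTransGen] at hxy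
      induction hxy with
      | refl => rfl
      | tail hr h ih =>
        rw [ih]
        have := h2 _ _ (S.trans hax (e.rel_of_rootGraph_reachable
          ((SimpleGraph.reachable_iff_reflTransGen _ _).2 hr))) h
        linarith

end

end ClassEnumeration

end KuroshData


/-! ### Measurability of the choices -/

theorem measurable_nat_sInf {Z : Type*} [MeasurableSpace Z] {P : ℕ → Z → Prop}
    (hP : ∀ n, Measurable (P n)) : Measurable fun z => sInf {n | P n z} := by
  refine measurable_to_countable' fun n => ?_
  -- The second alternative accounts for `sInf ∅ = 0`.
  have h : Measurable fun z => (P n z ∧ ∀ m, m < n → ¬ P m z) ∨ (n = 0 ∧ ∀ m, ¬ P m z) :=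
    ((hP n).and (.forall fun m => (measurable_const (a := m < n)).imp (hP m).not)).or
      (measurable_const.and (.forall fun m => (hP m).not))
  convert! measurableSet_setOfPred.2 h using 1
  ext z
  simp only [mem_preimage, mem_singleton_iff, mem_ofPred_eq]
  constructor
  · rintro rfl
    rcases eq_empty_or_nonempty {n | P n z} with he | hne
    · exact Or.inr ⟨by rw [he, Nat.sInf_empty], fun m hm => (eq_empty_iff_forall_notMem.1 he) m hm⟩
    · exact Or.inl ⟨Nat.sInf_mem hne, fun m hm => Nat.notMem_of_lt_sInf hm⟩
  · rintro (⟨h1, h2⟩ | ⟨rfl, h'⟩)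
    · exact le_antisymm (Nat.sInf_le h1) (not_lt.1 fun hlt => h2 _ hlt (Nat.sInf_mem (s := {n | P n z}) ⟨n, h1⟩))
    · rw [show {n | P n z} = ∅ from eq_empty_of_forall_notMem h', Nat.sInf_empty]

namespace ClassEnumeration

variable {X I : Type*} [MeasurableSpace X] {R : Setoid X} (e : ClassEnumeration R)
  {E : I → Setoid X} {S : Setoid X}

theorem measurable_map_comp {Z : Type*} [MeasurableSpace Z] {n : Z → ℕ} {g : Z → X}
    (hn : Measurable n) (hg : Measurable g) : Measurable fun z => e.map (n z) (g z) :=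
  (measurable_from_prod_countable_right (f := fun p : ℕ × X => e.map p.1 p.2)
    e.measurable_map).comp (hn.prodMk hg)

variable [Countable I]

section

variable (hR : ∀ i x y, E i x y → R x y) (hE : ∀ i, Measurable fun p : X × X => E i p.1 p.2)
  (hS : Measurable fun p : X × X => S p.1 p.2)
include e hR hE hS

/-- The quantifier over a class is replaced by one over the maps `e.map m`, hence countable; the
same device serves below. -/
theorem measurable_stepsToClass (n : ℕ) :
    Measurable fun p : X × X => StepsToClass E S n p.1 p.2 := by
  induction n with
  | zero => exact hS
  | succ n ih =>
    have : Measurable fun p : X × X =>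
        ∃ i m, E i p.2 (e.map m p.2) ∧ StepsToClass E S n p.1 (e.map m p.2) :=
      .exists fun i => .exists fun m =>
        ((hE i).comp (measurable_snd.prodMk ((e.measurable_map m).comp measurable_snd))).and
          (ih.comp (measurable_fst.prodMk ((e.measurable_map m).comp measurable_snd)))
    convert! this using 1
    funext p
    refine propext ⟨?_, fun ⟨i, m, h⟩ => ⟨i, _, h⟩⟩
    rintro ⟨i, y', h, h'⟩
    obtain ⟨m, -, rfl⟩ := e.exists_map_eq _ _ (hR i _ _ h)
    exact ⟨i, m, h, h'⟩

theorem measurable_classDist : Measurable fun p : X × X => classDist E S p.1 p.2 :=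
  measurable_nat_sInf fun n => e.measurable_stepsToClass hR hE hS n

variable {Z : Type*} [MeasurableSpace Z] {f g : Z → X} (hf : Measurable f) (hg : Measurable g)
include hf hg

theorem measurable_isLowest (i : I) :
    Measurable fun z => IsLowest E (classDist E S (f z)) i (g z) := by
  have hd := e.measurable_classDist hR hE hS
  have : Measurable fun z => ∀ m, E i (g z) (e.map m (g z)) →
      classDist E S (f z) (g z) ≤ classDist E S (f z) (e.map m (g z)) :=
    .forall fun m => ((hE i).comp (hg.prodMk ((e.measurable_map m).comp hg))).imp
      (measurableSet_setOfPred.1 (measurableSet_le (hd.comp (hf.prodMk hg))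
        (hd.comp (hf.prodMk ((e.measurable_map m).comp hg)))))
  convert! this using 1
  funext z
  refine propext ⟨fun h m hm => h _ hm, fun h y' hy => ?_⟩
  obtain ⟨m, -, rfl⟩ := e.exists_map_eq _ _ (hR i _ _ hy)
  exact h m hy

theorem measurable_toLowest (i : I) :
    Measurable fun z => e.toLowest E (classDist E S (f z)) i (g z) :=
  e.measurable_map_comp (measurable_nat_sInf fun m =>
    ((hE i).comp (hg.prodMk ((e.measurable_map m).comp hg))).and
      (e.measurable_isLowest hR hE hS hf ((e.measurable_map m).comp hg) i)) hg

theorem measurable_parent : Measurable fun z => e.parent E (classDist E S (f z)) (g z) :=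
  e.measurable_map_comp (measurable_nat_sInf fun m => .exists fun i =>
    ((hE i).comp (hg.prodMk ((e.measurable_map m).comp hg))).and
      ((e.measurable_isLowest hR hE hS hf ((e.measurable_map m).comp hg) i).and
        (e.measurable_isLowest hR hE hS hf hg i).not)) hg

theorem measurable_root : Measurable fun z => e.root E (classDist E S (f z)) (g z) := by
  have hit : ∀ n : ℕ, Measurable fun z => (e.parent E (classDist E S (f z)))^[n] (g z) := by
    intro n
    induction n with
    | zero => exact hg
    | succ n ih =>
      simp only [Function.iterate_succ_apply']
      exact e.measurable_parent hR hE hS hf ih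
  -- The number of iterations varies with `z` but takes countably many values.
  exact (measurable_from_prod_countable_right
    (f := fun p : ℕ × Z => (e.parent E (classDist E S (f p.2)))^[p.1] (g p.2)) hit).comp
      (((e.measurable_classDist hR hE hS).comp (hf.prodMk hg)).prodMk measurable_id)

variable [StandardBorelSpace X]

theorem measurable_rootIndex : Measurable fun z => e.rootIndex E (classDist E S (f z)) (g z) := by
  have hr := e.measurable_root hR hE hS hf hg
  exact measurable_nat_sInf fun n => (measurableSet_setOfPred.1 (hr (e.measurableSet_dom n))).and
    (measurableSet_setOfPred.1 (measurableSet_eq_fun ((e.measurable_map n).comp hr) hg))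

theorem measurable_isBase (i : I) :
    Measurable fun z => e.IsBase E (classDist E S (f z)) i (g z) := by
  have hm := fun m => (e.measurable_map m).comp hg
  have : Measurable fun z => IsLowest E (classDist E S (f z)) i (g z) ∧
      ∀ m, E i (g z) (e.map m (g z)) → IsLowest E (classDist E S (f z)) i (e.map m (g z)) →
        e.rootIndex E (classDist E S (f z)) (g z) ≤
          e.rootIndex E (classDist E S (f z)) (e.map m (g z)) :=
    (e.measurable_isLowest hR hE hS hf hg i).and (.forall fun m =>
      ((hE i).comp (hg.prodMk (hm m))).imp
        ((e.measurable_isLowest hR hE hS hf (hm m) i).imp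
          (measurableSet_setOfPred.1 (measurableSet_le (e.measurable_rootIndex hR hE hS hf hg)
            (e.measurable_rootIndex hR hE hS hf (hm m))))))
  convert! this using 1
  funext z
  refine propext (and_congr_right fun _ => ⟨fun h m hm => h _ hm, fun h y' hy => ?_⟩)
  obtain ⟨m, -, rfl⟩ := e.exists_map_eq _ _ (hR i _ _ hy)
  exact h m hy

theorem measurable_toBase (i : I) :
    Measurable fun z => e.toBase E (classDist E S (f z)) i (g z) :=
  e.measurable_map_comp (measurable_nat_sInf fun m =>
    ((hE i).comp (hg.prodMk ((e.measurable_map m).comp hg))).and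
      (e.measurable_isBase hR hE hS hf ((e.measurable_map m).comp hg) i)) hg

end

variable [StandardBorelSpace X] (hR : ∀ i x y, E i x y → R x y)
  (hE : ∀ i, Measurable fun p : X × X => E i p.1 p.2)
  (hS : Measurable fun p : X × X => S p.1 p.2)
include hR hE hS

theorem measurableSet_kuroshDom (i : I) (k : ℕ) : MeasurableSet (e.kuroshDom E S i k) := by
  have hk := e.measurable_map k
  exact measurableSet_setOfPred.2
    ((measurableSet_setOfPred.1 (measurableSet_eq_fun
      (e.measurable_root hR hE hS measurable_id hk) measurable_id)).and
    ((measurableSet_setOfPred.1 (measurableSet_eq_fun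
      (e.measurable_rootIndex hR hE hS measurable_id hk) measurable_const)).and
    (e.measurable_isBase hR hE hS measurable_id hk i)))

theorem measurable_rootEdge : Measurable fun p : X × X => e.RootEdge E S p.1 p.2 := by
  have hm := fun m => (e.measurable_map m).comp (measurable_fst : Measurable (Prod.fst : X × X → X))
  have hf : Measurable (Prod.fst : X × X → X) := measurable_fst
  have heq : ∀ {u v : X × X → X}, Measurable u → Measurable v → Measurable fun p => u p = v p :=
    fun hu hv => measurableSet_setOfPred.1 (measurableSet_eq_fun hu hv)
  have : Measurable fun p : X × X => S p.1 p.2 ∧ ∃ i m,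
      e.root E (classDist E S p.1) (e.map m p.1) = p.1 ∧
      (e.root E (classDist E S p.1) (e.toLowest E (classDist E S p.1) i (e.map m p.1)) = p.2 ∨
        IsLowest E (classDist E S p.1) i (e.map m p.1) ∧
        e.root E (classDist E S p.1) (e.toBase E (classDist E S p.1) i (e.map m p.1)) = p.2) :=
    hS.and (.exists fun i => .exists fun m =>
      (heq (e.measurable_root hR hE hS hf (hm m)) hf).and
        ((heq (e.measurable_root hR hE hS hf (e.measurable_toLowest hR hE hS hf (hm m) i))
          measurable_snd).or ((e.measurable_isLowest hR hE hS hf (hm m) i).and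
        (heq (e.measurable_root hR hE hS hf (e.measurable_toBase hR hE hS hf (hm m) i))
          measurable_snd))))
  convert! this using 1
  funext p
  refine propext (and_congr_right fun _ => exists_congr fun i => ⟨?_, ?_⟩)
  · rintro ⟨y, hy, h⟩
    obtain ⟨m, -, rfl⟩ := e.exists_map_eq _ _ hy
    exact ⟨m, h⟩
  · rintro ⟨m, h⟩
    exact ⟨_, e.rel m p.1, h⟩

theorem measurable_rootGraph_adj : Measurable fun p : X × X => (e.rootGraph E S).Adj p.1 p.2 := by
  have h := e.measurable_rootEdge hR hE hS
  simp only [rootGraph, SimpleGraph.fromRel_adj]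
  exact (measurableSet_setOfPred.1 (measurableSet_eq_fun measurable_fst measurable_snd)).not.and
    (h.or (h.comp measurable_swap))

/-- Neighbours stay in the `R`-class, so walks of each length are found by countable search. -/
theorem measurable_rootGraph_reachable (hSR : S ≤ R) :
    Measurable fun p : X × X => (e.rootGraph E S).Reachable p.1 p.2 := by
  have hadj := e.measurable_rootGraph_adj hR hE hS
  have hwalk : ∀ n : ℕ, Measurable fun p : X × X =>
      ∃ w : (e.rootGraph E S).Walk p.1 p.2, w.length = n := by
    intro n
    induction n with
    | zero =>
      convert! measurableSet_setOfPred.1 (measurableSet_eq_fun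
        (measurable_fst (α := X) (β := X)) measurable_snd) using 1
      funext ⟨x, y⟩
      exact propext ⟨fun ⟨w, hw⟩ => SimpleGraph.Walk.eq_of_length_eq_zero hw,
        fun h => by obtain rfl : x = y := h; exact ⟨.nil, rfl⟩⟩
    | succ n ih =>
      have : Measurable fun p : X × X => ∃ m, (e.rootGraph E S).Adj p.1 (e.map m p.1) ∧
          ∃ w : (e.rootGraph E S).Walk (e.map m p.1) p.2, w.length = n :=
        .exists fun m =>
          (hadj.comp (measurable_fst.prodMk ((e.measurable_map m).comp measurable_fst))).and
          (ih.comp (((e.measurable_map m).comp measurable_fst).prodMk measurable_snd))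
      convert! this using 1
      funext ⟨x, y⟩
      refine propext ⟨?_, ?_⟩
      · rintro ⟨w, hw⟩
        cases w with
        | nil => simp at hw
        | cons h w =>
          obtain ⟨m, -, rfl⟩ := e.exists_map_eq _ _ (hSR (e.rel_of_rootGraph_adj h))
          exact ⟨m, h, w, by simpa using hw⟩
      · rintro ⟨m, h, w, hw⟩
        exact ⟨.cons h w, by simpa using hw⟩
  convert! Measurable.exists hwalk using 1
  funext p
  exact propext ⟨fun ⟨w⟩ => ⟨_, w, rfl⟩, fun ⟨_, w, _⟩ => ⟨w⟩⟩

end ClassEnumeration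

/-! ### The decomposition -/

theorem mainTheorem1 {X : Type*} [MeasurableSpace X] [StandardBorelSpace X]
    {I : Type*} [Countable I]
    (R : Setoid X) (hR : IsBorelRel R) (hRc : HasCountableClasses R)
    (Rsub : I → Setoid X) (hRsub : ∀ i, IsBorelRel (Rsub i))
    (hfree : IsFreeProduct R (fun i x y => Rsub i x y))
    (S : Setoid X) (hS : IsBorelRel S) (hSR : S ≤ R) :
    ∃ (K : I → Type) (φ : (i : I) → K i → PartialEquiv X X) (T : Setoid X),
      (∀ i, Countable (K i)) ∧
      (∀ i k, φ i k ∈ fullPseudogroup R) ∧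
      IsBorelRel T ∧ T ≤ S ∧ IsTreeable T ∧
      IsFreeProduct S
        (Sum.elim (fun p : (i : I) × K i => kuroshFactor (Rsub p.1) S (φ p.1 p.2))
          (fun (_ : Unit) x y => T x y)) ∧
      ∀ i, ∃ k, (φ i k).source = Set.univ ∧
        ∀ x y, kuroshFactor (Rsub i) S (φ i k) x y ↔ (Rsub i x y ∧ S x y) := by
  obtain ⟨e⟩ := nonempty_classEnumeration hR hRc
  have hRsub' : ∀ i, Measurable fun p : X × X => Rsub i p.1 p.2 := fun i =>
    measurableSet_setOfPred.1 (hRsub i)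
  have hS' : Measurable fun p : X × X => S p.1 p.2 := measurableSet_setOfPred.1 hS
  refine ⟨fun _ => ℕ, e.kuroshMap Rsub S, (e.rootGraph Rsub S).reachableSetoid,
    fun _ => inferInstance, fun i k => ?_, ?_, ?_, ?_, e.isFreeProduct_kurosh hfree hSR,
    fun i => ⟨0, e.kuroshDom_zero i, fun x y => ?_⟩⟩
  · exact Set.InjOn.partialEquivImage_mem_fullPseudogroup _ (e.measurable_map k)
      (e.measurableSet_kuroshDom hfree.rel hRsub' hS' i k) (e.rel k)
  · exact measurableSet_setOfPred.2 (e.measurable_rootGraph_reachable hfree.rel hRsub' hS' hSR)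
  · exact fun x y h => e.rel_of_rootGraph_reachable h
  · exact ⟨e.rootGraph Rsub S, measurableSet_setOfPred.2
      (e.measurable_rootGraph_adj hfree.rel hRsub' hS'), e.isAcyclic_rootGraph hfree,
      fun _ _ => Iff.rfl⟩
  -- The index `k = 0` works: its map is the identity on all of `X`.
  · have hmem : ∀ x, x ∈ (e.kuroshMap Rsub S i 0).source := fun x =>
      by
      change x ∈ e.kuroshDom Rsub S i 0
      rw [e.kuroshDom_zero]
      trivial
    have hmap : ∀ x, e.kuroshMap Rsub S i 0 x = x := e.map_zero
    simp only [kuroshFactor, conjRel, restrictRel, hmap]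
    exact ⟨fun h => ⟨h.1.2.2.2.2, h.2⟩, fun h => ⟨⟨hmem x, hmem y, ⟨x, hmem x, rfl⟩,
      ⟨y, hmem y, rfl⟩, h.1⟩, h.2⟩⟩
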